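/- **Model.** A network is a finite simple undirected graph $G=(V,E)$ with $n$ nodes and maximum degree $\Delta$. The nodes have pairwise distinct identifiers of $O(\log n)$ bits. All nodes run the same deterministic algorithm in synchronous rounds; in each round a node may send a (possibly different) message to each neighbor, receives its neighbors' messages, and performs arbitrary internal computation. Initially a node knows $n$, $\Delta$, its own identifier, the identifiers of its neighbors, and its private input. In the $\mathsf{CONGEST}$ model every message has at most $O(\log n)$ bits. The time is the number of rounds until all nodes have (irrevocably) output. Logarithms are to base 2. **Theorem 2.** Let $P$ be a polynomial. There is a deterministic $\mathsf{CONGEST}$ algorithm that, on every $n$-node graph $G=(V,E)$ of maximum degree $\Delta$ in which every node $v$ is given as input a list $L_v$ of at least $\deg(v)+1$ colors from the color space $\{0,\dots,P(\Delta)-1\}$, computes a color $x_v\in L_v$ for every node $v$ such that $x_u\neq x_v$ for every edge $\{u,v\}\in E$. It takes at most $2^{O(\sqrt{\log\Delta})}\cdot\log n$ rounds, where for $\Delta=0$ the first factor is read as $1$. The constants hidden in this bound and in the message size depend only on $P$ and on the constant in the length of the identifiers. In particular, there is a deterministic $\mathsf{CONGEST}$ algorithm, without private inputs, that computes a proper coloring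 with $\Delta+1$ colors of every $n$-node graph of maximum degree $\Delta$ in $2^{O(\sqrt{\log\Delta})}\cdot\log n$ rounds. -/

import Mathlib

/-- What a node knows before the first round: the number of nodes, the maximum degree, its own
identifier, the identifiers of its neighbours, and its private input. -/
structure NodeView (I : Type) where
  nodeCount : ℕ
  maxDeg : ℕ
  ident : ℕ
  nbrIdents : Finset ℕ
  input : I

/-- A deterministic synchronous message-passing algorithm with private inputs in `I` and outputs
in `O`. All nodes run the same algorithm, and internal computation is arbitrary.
In a round, a node in state `s` sends to its neighbour with identifier `i` the bit string
`send s i`; it then receives the set of pairs (identifier of a neighbour, message of that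
neighbour) and moves to its next state by `step`. A node has decided as soon as `output` is not
`none`, and decisions are irrevocable. -/
structure DistAlgorithm (I O : Type) where
  State : Type
  init : NodeView I → State
  send : State → ℕ → List Bool
  step : State → Finset (ℕ × List Bool) → State
  output : State → Option O
  output_final : ∀ (s : State) (r : Finset (ℕ × List Bool)) (o : O),
    output s = some o → output (step s r) = some o

namespace DistAlgorithm

variable {I O : Type} {V : Type*} [Fintype V]

/-- The state of each node after `t` rounds on the network `G` with identifiers `ident` and
private inputs `inp`. -/
def stateAt (A : DistAlgorithm I O) (G : SimpleGraph V) [DecidableRel G.Adj]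
    (ident : V → ℕ) (inp : V → I) : ℕ → V → A.State
  | 0, v => A.init
      { nodeCount := Fintype.card V
        maxDeg := G.maxDegree
        ident := ident v
        nbrIdents := (G.neighborFinset v).image ident
        input := inp v }
  | t + 1, v => A.step (A.stateAt G ident inp t v)
      ((G.neighborFinset v).image fun u =>
        (ident u, A.send (A.stateAt G ident inp t u) (ident v)))

/-- Every message sent in the execution, in any round and over any edge, has at most `b` bits. -/
def MessagesAtMost (A : DistAlgorithm I O) (G : SimpleGraph V) [DecidableRel G.Adj]
    (ident : V → ℕ) (inp : V → I) (b : ℝ) : Prop :=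
  ∀ (t : ℕ) (v u : V), G.Adj v u →
    ((A.send (A.stateAt G ident inp t v) (ident u)).length : ℝ) ≤ b

/-- After `t` rounds every node `v` has decided, and its output is `x v`. -/
def OutputsAfter (A : DistAlgorithm I O) (G : SimpleGraph V) [DecidableRel G.Adj]
    (ident : V → ℕ) (inp : V → I) (t : ℕ) (x : V → O) : Prop :=
  ∀ v : V, A.output (A.stateAt G ident inp t v) = some (x v)

end DistAlgorithm

/-- Unique identifiers of at most `a * log₂ n` bits on an `n`-element node set. -/
def ValidIdents {V : Type*} [Fintype V] (a : ℕ) (ident : V → ℕ) : Prop :=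
  Function.Injective ident ∧ ∀ v : V, ident v < Fintype.card V ^ a

/-- The round bound `2 ^ (K * √(log₂ Δ)) * log₂ n`. -/
noncomputable def roundBound (K : ℝ) (n Δ : ℕ) : ℝ :=
  (2 : ℝ) ^ (K * √(Real.logb 2 (Δ : ℝ))) * Real.logb 2 (n : ℝ)

/-! The coloring is built in phases, each of which colors a `2 ^ (-O(√log Δ))` fraction of the
uncolored nodes, so `2 ^ O(√log Δ) * log n` phases suffice (`runs_colorAll`).

In a phase every uncolored node fixes a candidate color digit by digit, with about `s = √log Δ`
digits in base `p = 2 ^ O(s)`. The potential is the sum of `deg_H(v) / |L_v|` (`conflictRatio`),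
where `H` keeps the edges whose endpoints have made the same choices so far. Lists are longer than
degrees, so it starts at no more than the number of uncolored nodes. A digit chosen at random, with
probability proportional to the number of list colors having it, keeps the expected potential
bounded by a constant times the old one. The choice is derandomized by conditional expectations, and
one digit at most triples the potential (`conflictRatio_split_le`, `runs_split`). After `s` digits
the lists are singletons and the conflict graph has average degree at most `3 ^ s`. A maximal
independent set of its nodes of degree at most `D = 2 * 3 ^ s` contains a `1 / (2 * (D + 1))`
fraction of the uncolored nodes (`card_le_of_maximal_independent`), and its members keep their
candidates.

Conditional expectations and the independent set need a schedule in which neighbors do not act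
together. Identifiers are first reduced to a proper coloring with `poly(Δ)` colors in `O(log n)`
rounds (`runs_reduceColors`). From it, one round of polynomial hashing gives a coloring with `2 ^
O(s)` colors and few monochromatic edges (`runs_recolor`); the classes act in turn, and
monochromatic edges are paid for separately. -/

/-! ### Broadcast programs and their synchronous execution. -/

/-- A node program with results in `α`: either it has finished, or it broadcasts a number to all
neighbours and continues with a function giving the number received from each identifier. -/
inductive Prog (α : Type) : Type
  | ret (a : α) : Prog α
  | bcast (m : ℕ) (k : (ℕ → ℕ) → Prog α) : Prog α

namespace Prog

/-- Sequential composition of node programs. -/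
def bind {α β : Type} : Prog α → (α → Prog β) → Prog β
  | ret a, f => f a
  | bcast m k, f => bcast m fun r => (k r).bind f

/-- Broadcast a number and return what was received. -/
def exchange (m : ℕ) : Prog (ℕ → ℕ) := bcast m ret

/-- Run the loop body `f 0, …, f (n - 1)`, passing on a local state. -/
def iter {α : Type} : (n : ℕ) → (f : ℕ → α → Prog α) → α → Prog α
  | 0, _, a => ret a
  | n + 1, f, a => (iter n f a).bind (f n)

/-- The decoding of a set of labelled bit strings: the number received from each identifier. -/
noncomputable def decode (r : Finset (ℕ × List Bool)) (i : ℕ) : ℕ :=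
  sSup {m : ℕ | (i, m.bits) ∈ r}

/-- The bit string sent to every neighbour in the next round. -/
def message {α : Type} : Prog α → List Bool
  | ret _ => []
  | bcast m _ => m.bits

/-- The remaining program after receiving `r`. -/
noncomputable def receive {α : Type} : Prog α → Finset (ℕ × List Bool) → Prog α
  | ret a, _ => ret a
  | bcast _ k, r => k (decode r)

/-- The result of a program that has finished. -/
def result {α : Type} : Prog α → Option α
  | ret a => some a
  | bcast _ _ => none

/-- The distributed algorithm in which every node runs a program depending on its view. -/
noncomputable def toAlgorithm {I O : Type} (π : NodeView I → Prog O) : DistAlgorithm I O where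
  State := Prog O
  init := π
  send s _ := s.message
  step := receive
  output := result
  output_final s r o h := by
    cases s with
    | ret a => exact h
    | bcast m k => simp [result] at h

end Prog

section Runs

variable {V : Type*} [Fintype V] (G : SimpleGraph V) [DecidableRel G.Adj] (ident : V → ℕ) (M : ℕ)

/-- What `v` receives, by identifier, when every node `u` broadcasts `m u`. -/
def inbox (m : V → ℕ) (v : V) (i : ℕ) : ℕ :=
  ∑ u ∈ G.neighborFinset v with ident u = i, m u

variable {G ident} in
theorem inbox_apply (hid : Function.Injective ident) (m : V → ℕ) {v u : V} (h : G.Adj v u) :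
    inbox G ident m v (ident u) = m u := by
  have : (G.neighborFinset v).filter (fun w => ident w = ident u) = {u} := by
    ext w
    simp only [Finset.mem_filter, SimpleGraph.mem_neighborFinset, Finset.mem_singleton]
    exact ⟨fun hw => hid hw.2, by rintro rfl; exact ⟨h, rfl⟩⟩
  rw [inbox, this, Finset.sum_singleton]

/-- `Exec G ident M t π y`: if each node `v` runs `π v`, then all nodes finish after exactly `t`
rounds with results `y`, and all messages are numbers below `M`. -/
inductive Exec {α : Type} : ℕ → (V → Prog α) → (V → α) → Prop
  | ret (y : V → α) : Exec 0 (fun v => .ret (y v)) y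
  | bcast (m : V → ℕ) (k : V → (ℕ → ℕ) → Prog α) (t : ℕ) (y : V → α) (hm : ∀ v, m v < M)
      (h : Exec t (fun v => k v (inbox G ident m v)) y) :
      Exec (t + 1) (fun v => .bcast (m v) (k v)) y

/-- The synchronous execution of `π` takes exactly `t` rounds, uses only messages below `M`, and
its results satisfy `Q`. -/
def Runs {α : Type} (t : ℕ) (π : V → Prog α) (Q : (V → α) → Prop) : Prop :=
  ∃ y, Exec G ident M t π y ∧ Q y

variable {G ident M} {α β : Type}

theorem Exec.bind {s t : ℕ} {π : V → Prog α} {y : V → α} {f : V → α → Prog β} {z : V → β}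
    (h : Exec G ident M s π y) (h' : Exec G ident M t (fun v => f v (y v)) z) :
    Exec G ident M (t + s) (fun v => (π v).bind (f v)) z := by
  induction h with
  | ret y => exact h'
  | bcast m k r y hm _ ih =>
    exact Exec.bcast m (fun v x => (k v x).bind (f v)) (t + r) z hm (ih h')

theorem Runs.ret {y : V → α} {Q : (V → α) → Prop} (h : Q y) :
    Runs G ident M 0 (fun v => .ret (y v)) Q :=
  ⟨y, Exec.ret y, h⟩

theorem Runs.bind {s t : ℕ} {π : V → Prog α} {f : V → α → Prog β} {Q : (V → α) → Prop}
    {R : (V → β) → Prop} (h : Runs G ident M s π Q)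
    (h' : ∀ y, Q y → Runs G ident M t (fun v => f v (y v)) R) :
    Runs G ident M (t + s) (fun v => (π v).bind (f v)) R := by
  obtain ⟨y, hy, hQ⟩ := h
  obtain ⟨z, hz, hR⟩ := h' y hQ
  exact ⟨z, hy.bind hz, hR⟩

theorem Runs.exchange {m : V → ℕ} (hm : ∀ v, m v < M) :
    Runs G ident M 1 (fun v => Prog.exchange (m v)) (fun y => y = inbox G ident m) :=
  ⟨_, Exec.bcast m _ 0 _ hm (Exec.ret _), rfl⟩

/-- An exchange followed by a program. -/
theorem Runs.exchange_bind {m : V → ℕ} {t : ℕ} {f : V → (ℕ → ℕ) → Prog β}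
    {R : (V → β) → Prop} (hm : ∀ v, m v < M)
    (h : Runs G ident M t (fun v => f v (inbox G ident m v)) R) :
    Runs G ident M (t + 1) (fun v => (Prog.exchange (m v)).bind (f v)) R :=
  (Runs.exchange hm).bind fun _ hy => hy ▸ h

theorem Runs.mono {t : ℕ} {π : V → Prog α} {Q R : (V → α) → Prop} (h : Runs G ident M t π Q)
    (hQR : ∀ y, Q y → R y) : Runs G ident M t π R := by
  obtain ⟨y, hy, hQ⟩ := h
  exact ⟨y, hy, hQR y hQ⟩

theorem Runs.iter {τ : ℕ} {f : V → ℕ → α → Prog α} (Inv : ℕ → (V → α) → Prop) (n : ℕ)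
    (hstep : ∀ k < n, ∀ y, Inv k y → Runs G ident M τ (fun v => f v k (y v)) (Inv (k + 1)))
    {y : V → α} (h0 : Inv 0 y) :
    Runs G ident M (n * τ) (fun v => Prog.iter n (f v) (y v)) (Inv n) := by
  induction n with
  | zero => simpa [Prog.iter] using Runs.ret h0
  | succ n ih =>
    rw [Nat.succ_mul, Nat.add_comm]
    exact (ih fun k hk => hstep k (hk.trans n.lt_succ_self)).bind (hstep n n.lt_succ_self)

end Runs

namespace Prog

variable {V : Type*} [Fintype V] {G : SimpleGraph V} [DecidableRel G.Adj] {ident : V → ℕ} {M : ℕ}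
  {I O : Type}

theorem bits_injective : Function.Injective Nat.bits := fun a b h =>
  Nat.digits.injective 2 (by rw [Nat.digits_two_eq_bits, Nat.digits_two_eq_bits, h])

/-- Distinct identifiers and injective binary encodings leave one candidate message per neighbor.
For any other identifier the supremum and the sum are both empty, hence `0`. -/
theorem decode_image (hid : Function.Injective ident) (m : V → ℕ) (v : V) :
    decode ((G.neighborFinset v).image fun u => (ident u, (m u).bits)) = inbox G ident m v := by
  funext i
  by_cases h : ∃ u, G.Adj v u ∧ ident u = i
  · obtain ⟨u, hu, rfl⟩ := h
    rw [inbox_apply hid m hu, decode]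
    have : {k : ℕ | (ident u, k.bits) ∈
        (G.neighborFinset v).image fun u => (ident u, (m u).bits)} = {m u} := by
      ext k
      simp only [Finset.mem_image, SimpleGraph.mem_neighborFinset, Prod.mk.injEq,
        Set.mem_ofPred_eq, Set.mem_singleton_iff]
      constructor
      · rintro ⟨w, _, hw, hk⟩
        rw [hid hw] at hk
        exact (bits_injective hk).symm
      · rintro rfl
        exact ⟨u, hu, rfl, rfl⟩
    rw [this, csSup_singleton]
  · have h1 : {k : ℕ | (i, k.bits) ∈
        (G.neighborFinset v).image fun u => (ident u, (m u).bits)} = ∅ := by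
      ext k
      simp only [Finset.mem_image, SimpleGraph.mem_neighborFinset, Prod.mk.injEq,
        Set.mem_ofPred_eq, Set.mem_empty_iff_false, iff_false]
      rintro ⟨w, hw, hi, _⟩
      exact h ⟨w, hw, hi⟩
    rw [decode, h1, inbox, Finset.sum_eq_zero]
    · simp
    · intro u hu
      simp only [Finset.mem_filter, SimpleGraph.mem_neighborFinset] at hu
      exact absurd ⟨u, hu⟩ h

/-- The view of node `v` in the network. -/
abbrev _root_.SimpleGraph.view (G : SimpleGraph V) [DecidableRel G.Adj] (ident : V → ℕ)
    (inp : V → I) (v : V) : NodeView I where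
  nodeCount := Fintype.card V
  maxDeg := G.maxDegree
  ident := ident v
  nbrIdents := (G.neighborFinset v).image ident
  input := inp v

/-- One round of a network in which every node `v` runs `π v`. -/
noncomputable def next (G : SimpleGraph V) [DecidableRel G.Adj] (ident : V → ℕ)
    (π : V → Prog O) (v : V) : Prog O :=
  (π v).receive ((G.neighborFinset v).image fun u => (ident u, (π u).message))

theorem stateAt_toAlgorithm (π : NodeView I → Prog O) (inp : V → I) (t : ℕ) :
    (toAlgorithm π).stateAt G ident inp t
      = ((next G ident)^[t] fun v => π (G.view ident inp v) : V → Prog O) := by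
  induction t with
  | zero => rfl
  | succ t ih =>
    rw [Function.iterate_succ_apply', ← ih]
    rfl

/-- A finished program is fixed by `next` and sends the empty string, so the length bound also
covers the rounds after `t`. -/
theorem iterate_next_of_exec (hid : Function.Injective ident) {t : ℕ}
    {π : V → Prog O} {y : V → O} (h : Exec G ident M t π y) :
    (next G ident)^[t] π = (fun v => .ret (y v)) ∧
    ∀ s v, ((next G ident)^[s] π v).message.length ≤ M.size := by
  induction h with
  | ret y =>
    refine ⟨rfl, fun s v => ?_⟩
    rw [Function.iterate_fixed (by rfl) s]
    exact Nat.zero_le _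
  | bcast m k t y hm _ ih =>
    have h1 : next G ident (fun v => (bcast (m v) (k v) : Prog O))
        = fun v => k v (inbox G ident m v) := by
      funext v
      rw [← decode_image hid]
      rfl
    refine ⟨by rw [Function.iterate_succ_apply, h1]; exact ih.1, fun s v => ?_⟩
    cases s with
    | zero =>
      change (m v).bits.length ≤ M.size
      rw [Nat.size_eq_bits_len]
      exact Nat.size_le_size (hm v).le
    | succ s =>
      rw [Function.iterate_succ_apply, h1]
      exact ih.2 s v

/-- The bound on `M.size` is required only in the presence of an edge, because `b` will be a
multiple of `logb 2 n`, which vanishes for a single node. -/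
theorem messagesAtMost_and_outputsAfter (hid : Function.Injective ident)
    (π : NodeView I → Prog O) (inp : V → I) {t : ℕ} {Q : (V → O) → Prop}
    (h : Runs G ident M t (fun v => π (G.view ident inp v)) Q) {b : ℝ}
    (hb : ∀ v u, G.Adj v u → (M.size : ℝ) ≤ b) :
    (toAlgorithm π).MessagesAtMost G ident inp b ∧
      ∃ y, Q y ∧ (toAlgorithm π).OutputsAfter G ident inp t y := by
  obtain ⟨y, hy, hQ⟩ := h
  obtain ⟨h1, h2⟩ := iterate_next_of_exec hid hy
  refine ⟨fun s v u huv => ?_, y, hQ, fun v => ?_⟩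
  · rw [stateAt_toAlgorithm]
    exact (Nat.cast_le.2 (h2 s v)).trans (hb v u huv)
  · rw [stateAt_toAlgorithm, h1]
    rfl

end Prog

/-! ### Minimizers and hash families with few agreements. -/

/-- A minimizer of `f` on the nonempty set `s`. -/
noncomputable def argminOn {α : Type} [LinearOrder α] (s : Finset ℕ) (f : ℕ → α) : ℕ :=
  if h : s.Nonempty then (s.exists_min_image f h).choose else 0

theorem argminOn_mem {α : Type} [LinearOrder α] {s : Finset ℕ} (h : s.Nonempty) (f : ℕ → α) :
    argminOn s f ∈ s := by
  rw [argminOn, dif_pos h]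
  exact (s.exists_min_image f h).choose_spec.1

theorem apply_argminOn_le {α : Type} [LinearOrder α] {s : Finset ℕ} (f : ℕ → α) {x : ℕ}
    (hx : x ∈ s) : f (argminOn s f) ≤ f x := by
  rw [argminOn, dif_pos ⟨x, hx⟩]
  exact (s.exists_min_image f ⟨x, hx⟩).choose_spec.2 x hx

/-- A function `hash c` with values below `size` for every color `c`. -/
structure HashFamily where
  size : ℕ
  hash : ℕ → ℕ → ℕ

/-- The functions of the colors below `m` agree pairwise in at most `d` points below `size`, which
lies between `k` and `2 * k`. -/
structure HashFamily.Good (F : HashFamily) (m d k : ℕ) : Prop where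
  lt_size : k < F.size
  size_le : F.size ≤ 2 * k
  hash_lt : ∀ c x, F.hash c x < F.size
  agree : ∀ c < m, ∀ c' < m, c ≠ c' →
    ((Finset.range F.size).filter fun x => F.hash c x = F.hash c' x).card ≤ d

/-- Polynomials of degree at most `d` over a prime field form a hash family. -/
theorem HashFamily.exists_good {m d k : ℕ} (hk : k ≠ 0) (hm : m ≤ k ^ (d + 1)) :
    ∃ F : HashFamily, F.Good m d k := by
  obtain ⟨q, hq, hkq, hqk⟩ := Nat.exists_prime_lt_and_le_two_mul k hk
  have := Fact.mk hq
  -- There are `q ^ (d + 1) ≥ m` polynomials of degree at most `d`, so the colors get distinct ones,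
  -- and the difference of two has at most `d` roots.
  have hcard : Fintype.card (Fin m) ≤ Fintype.card (Fin (d + 1) → ZMod q) := by
    simp only [Fintype.card_fin, Fintype.card_pi, ZMod.card, Finset.prod_const, Finset.card_univ]
    exact hm.trans (Nat.pow_le_pow_left hkq.le _)
  obtain ⟨φ⟩ := Function.Embedding.nonempty_of_card_le hcard
  let P : Fin m → Polynomial (ZMod q) := fun c =>
    ((Polynomial.degreeLTEquiv (ZMod q) (d + 1)).symm (φ c)).1
  have hPinj : Function.Injective P := fun a b h =>
    φ.injective ((Polynomial.degreeLTEquiv (ZMod q) (d + 1)).symm.injective (Subtype.ext h))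
  refine ⟨⟨q, fun c x => if h : c < m then ((P ⟨c, h⟩).eval (x : ZMod q)).val else 0⟩,
    ⟨hkq, hqk, fun c x => ?_, fun c hc c' hc' hne => ?_⟩⟩
  · dsimp only
    split_ifs
    · exact ZMod.val_lt _
    · exact hq.pos
  · simp only [hc, hc', dif_pos]
    set R := P ⟨c, hc⟩ - P ⟨c', hc'⟩ with hR
    have hR0 : R ≠ 0 := fun h => hne (by
      have := hPinj (sub_eq_zero.1 h)
      simpa using this)
    have hdeg : R.natDegree ≤ d := by
      have : R ∈ Polynomial.degreeLT (ZMod q) (d + 1) :=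
        Submodule.sub_mem _ (Subtype.property _) (Subtype.property _)
      rw [Polynomial.mem_degreeLT] at this
      exact Nat.lt_succ_iff.1 ((Polynomial.natDegree_lt_iff_degree_lt hR0).2 this)
    refine le_trans ?_ ((Polynomial.card_roots' R).trans hdeg)
    refine le_trans ?_ (Multiset.toFinset_card_le R.roots)
    refine Finset.card_le_card_of_injOn (fun x => (x : ZMod q)) (fun x hx => ?_)
      (fun x hx y hy hxy => ?_)
    · simp only [Finset.coe_filter, Finset.mem_range, Set.mem_ofPred_eq] at hx
      refine Multiset.mem_toFinset.2 ((Polynomial.mem_roots hR0).2 ?_)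
      rw [Polynomial.IsRoot.def, hR, Polynomial.eval_sub, sub_eq_zero]
      exact ZMod.val_injective q hx.2
    · simp only [Finset.coe_filter, Finset.mem_range, Set.mem_ofPred_eq] at hx hy
      have := (ZMod.natCast_eq_natCast_iff' x y q).1 hxy
      rwa [Nat.mod_eq_of_lt hx.1, Nat.mod_eq_of_lt hy.1] at this

/-- A hash family with the given parameters. -/
noncomputable def goodHash (m d k : ℕ) : HashFamily :=
  open Classical in
  if h : ∃ F : HashFamily, F.Good m d k then h.choose else ⟨0, fun _ _ => 0⟩

/-- The family depends on the three parameters alone, so all nodes use the same one without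
communication. -/
theorem goodHash_good {m d k : ℕ} (hk : k ≠ 0) (hm : m ≤ k ^ (d + 1)) :
    (goodHash m d k).Good m d k := by
  have h := HashFamily.exists_good hk hm
  rw [goodHash, dif_pos h]
  exact h.choose_spec

theorem filter_image_ident {V : Type*} {ident : V → ℕ} {s : Finset V} (p : ℕ → Prop) (q : V → Prop)
    [DecidablePred p] [DecidablePred q] (h : ∀ u ∈ s, (p (ident u) ↔ q u)) :
    (s.image ident).filter p = (s.filter q).image ident := by
  rw [Finset.filter_image]
  exact congrArg _ (Finset.filter_congr h)

/-! ### Recoloring with few monochromatic edges, and color reduction. -/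

section

variable {V : Type*} [Fintype V] {G : SimpleGraph V} [DecidableRel G.Adj] {ident : V → ℕ} {M : ℕ}

/-- `H` lists the neighbours in a subgraph of `G`. -/
structure IsSubnetwork (G : SimpleGraph V) (H : V → Finset V) : Prop where
  adj : ∀ {v u}, u ∈ H v → G.Adj v u
  symm : ∀ {v u}, u ∈ H v → v ∈ H u

namespace Prog

/-- Reduce the number of colors: choose a point where the hash value of the own color `c` agrees
with that of few neighbours in `N`; the new color consists of the point and the hash value. -/
noncomputable def recolor (F : HashFamily) (c : ℕ) (N : Finset ℕ) : Prog ℕ :=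
  (exchange c).bind fun r =>
    ret (let x := argminOn (Finset.range F.size) fun x =>
      (N.filter fun i => F.hash (r i) x = F.hash c x).card
    x * F.size + F.hash c x)

/-- Each neighbor has another old color and so agrees with `v` in at most `d` points; a best point
has at most the average number `d * (H v).card / F.size` of agreements. Equal new colors mean equal
points and an agreement there. -/
theorem runs_recolor (hid : Function.Injective ident) {F : HashFamily} {m d k : ℕ}
    (hF : F.Good m d k) {H : V → Finset V} (hH : IsSubnetwork G H) {c : V → ℕ}
    (hcm : ∀ v, c v < m) (hcM : ∀ v, c v < M) (hc : ∀ v, ∀ u ∈ H v, c u ≠ c v) :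
    Runs G ident M 1 (fun v => recolor F (c v) ((H v).image ident)) fun ψ =>
      (∀ v, ψ v < F.size * F.size) ∧
      ∀ v, F.size * ((H v).filter fun u => ψ u = ψ v).card ≤ d * (H v).card := by
  refine Runs.exchange_bind hcM (Runs.ret ?_)
  have hpos : 0 < F.size := (Nat.zero_le k).trans_lt hF.lt_size
  have hne : (Finset.range F.size).Nonempty := Finset.nonempty_range_iff.2 hpos.ne'
  have hcount : ∀ v x, (((H v).image ident).filter fun i =>
      F.hash (inbox G ident c v i) x = F.hash (c v) x).card
        = ((H v).filter fun u => F.hash (c u) x = F.hash (c v) x).card := by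
    intro v x
    rw [filter_image_ident _ (fun u => F.hash (c u) x = F.hash (c v) x),
      Finset.card_image_of_injective _ hid]
    intro u hu
    rw [inbox_apply hid c (hH.adj hu)]
  simp only [hcount]
  set x : V → ℕ := fun v => argminOn (Finset.range F.size) fun x =>
    ((H v).filter fun u => F.hash (c u) x = F.hash (c v) x).card with hx
  have hxlt : ∀ v, x v < F.size := fun v => Finset.mem_range.1 (argminOn_mem hne _)
  refine ⟨fun v => ?_, fun v => ?_⟩
  · change x v * F.size + F.hash (c v) (x v) < _
    have h1 := hF.hash_lt (c v) (x v)
    have h2 := Nat.mul_le_mul_right F.size (Nat.succ_le_of_lt (hxlt v))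
    rw [Nat.succ_mul] at h2
    omega
  · have hsub : ((H v).filter fun u => x u * F.size + F.hash (c u) (x u)
          = x v * F.size + F.hash (c v) (x v)) ⊆
        (H v).filter fun u => F.hash (c u) (x v) = F.hash (c v) (x v) := by
      refine Finset.monotone_filter_right _ fun u _ hu => ?_
      -- Hash values are below `F.size`, so division recovers the point.
      have h1 : x u = x v := by
        have := congrArg (· / F.size) hu
        simpa [Nat.add_div_of_dvd_right, Nat.mul_div_cancel _ hpos,
          Nat.div_eq_of_lt (hF.hash_lt _ _)] using this
      rw [h1] at hu
      exact Nat.add_left_cancel hu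
    calc F.size * _ ≤ F.size * _ := Nat.mul_le_mul_left _ (Finset.card_le_card hsub)
      _ = ∑ _y ∈ Finset.range F.size,
          ((H v).filter fun u => F.hash (c u) (x v) = F.hash (c v) (x v)).card := by
        rw [Finset.sum_const, Finset.card_range, smul_eq_mul]
      _ ≤ ∑ y ∈ Finset.range F.size,
          ((H v).filter fun u => F.hash (c u) y = F.hash (c v) y).card :=
        Finset.sum_le_sum fun y hy => apply_argminOn_le (fun x =>
          ((H v).filter fun u => F.hash (c u) x = F.hash (c v) x).card) hy
      _ = ∑ u ∈ H v,
          ((Finset.range F.size).filter fun y => F.hash (c u) y = F.hash (c v) y).card :=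
        Finset.sum_card_bipartiteAbove_eq_sum_card_bipartiteBelow
          (fun y u => F.hash (c u) y = F.hash (c v) y)
      _ ≤ ∑ _u ∈ H v, d := Finset.sum_le_sum fun u hu =>
        hF.agree _ (hcm u) _ (hcm v) (hc v u hu)
      _ = d * (H v).card := by rw [Finset.sum_const, smul_eq_mul, Nat.mul_comm]

/-- Reduce a proper coloring with `2 ^ (b + e)` colors to one with `2 ^ b` colors. -/
noncomputable def reduceColors (b e c : ℕ) (N : Finset ℕ) : Prog ℕ :=
  iter e (fun r c => recolor (goodHash (2 ^ (b + e - r)) 2 (2 ^ ((b + e - r + 2) / 3))) c N) c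

/-- Every round saves one bit: from `β` bits, quadratic polynomials lead to at most `2 * ((β + 2) /
3) + 2 ≤ β - 1` bits, since `β > b ≥ 13`. The field has more than `2 * Δ` elements, so the defect
bound `2 * Δ / F.size` is below one and the coloring stays proper. This slow rate is enough, as
logarithmically many rounds are allowed anyway. -/
theorem runs_reduceColors (hid : Function.Injective ident) {b e : ℕ} (hb : 13 ≤ b)
    (hΔ : 2 * G.maxDegree ≤ 2 ^ (b / 3)) (hM : 2 ^ (b + e) ≤ M) {c : V → ℕ}
    (hc : ∀ v, c v < 2 ^ (b + e)) (hcG : ∀ v u, G.Adj v u → c u ≠ c v) :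
    Runs G ident M (e * 1)
      (fun v => reduceColors b e (c v) ((G.neighborFinset v).image ident)) fun ψ =>
        (∀ v, ψ v < 2 ^ b) ∧ ∀ v u, G.Adj v u → ψ u ≠ ψ v := by
  have hH : IsSubnetwork G fun v => G.neighborFinset v :=
    ⟨fun h => by simpa using h, fun h => by simpa using (by simpa using h : G.Adj _ _).symm⟩
  refine (Runs.iter (fun r ψ => (∀ v, ψ v < 2 ^ (b + e - r)) ∧ ∀ v u, G.Adj v u → ψ u ≠ ψ v) e
    (fun r hr ψ hψ => ?_) ⟨by simpa using hc, hcG⟩).mono fun ψ hψ => by simpa using hψ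
  obtain ⟨β, hβ⟩ : ∃ β, β = b + e - r := ⟨_, rfl⟩
  have hβb : b + 1 ≤ β := by omega
  rw [← hβ] at hψ ⊢
  have hF : (goodHash (2 ^ β) 2 (2 ^ ((β + 2) / 3))).Good (2 ^ β) 2 (2 ^ ((β + 2) / 3)) := by
    refine goodHash_good (by positivity) ?_
    rw [← pow_mul]
    exact Nat.pow_le_pow_right two_pos (by omega)
  set F := goodHash (2 ^ β) 2 (2 ^ ((β + 2) / 3))
  refine (runs_recolor hid hF hH hψ.1
    (fun v => (hψ.1 v).trans_le ((Nat.pow_le_pow_right two_pos (by omega)).trans hM))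
    (fun v u hu => hψ.2 v u (hH.adj hu))).mono fun χ hχ => ⟨fun v => ?_, fun v u huv heq => ?_⟩
  · refine (hχ.1 v).trans_le ((Nat.mul_le_mul hF.size_le hF.size_le).trans ?_)
    rw [← pow_succ', ← pow_add]
    exact Nat.pow_le_pow_right two_pos (by omega)
  · have h1 : 0 < ((G.neighborFinset v).filter fun u => χ u = χ v).card :=
      Finset.card_pos.2 ⟨u, by simp [huv, heq]⟩
    have h2 := hχ.2 v
    have h3 : (G.neighborFinset v).card ≤ G.maxDegree := by
      rw [G.card_neighborFinset_eq_degree]; exact G.degree_le_maxDegree v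
    have h4 : F.size ≤ F.size * ((G.neighborFinset v).filter fun u => χ u = χ v).card :=
      Nat.le_mul_of_pos_right _ h1
    have h5 : 2 ^ (b / 3) ≤ 2 ^ ((β + 2) / 3) := Nat.pow_le_pow_right two_pos (by omega)
    have h6 := hF.lt_size
    omega

end Prog

end

/-! ### Conditional expectations for the choice of list parts. -/

section ConditionalExpectation

open Finset

variable {V : Type*} [Fintype V] {B : V → Finset V}

theorem sum_sum_comm_of_symm (hB : ∀ {v u}, u ∈ B v → v ∈ B u) (f : V → V → ℚ) :
    ∑ v, ∑ u ∈ B v, f v u = ∑ v, ∑ u ∈ B v, f u v :=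
  Finset.sum_comm' fun _ _ => ⟨fun h => ⟨hB h.2, mem_univ _⟩, fun h => ⟨mem_univ _, hB h.1⟩⟩

theorem sum_sum_add_of_symm (hB : ∀ {v u}, u ∈ B v → v ∈ B u) (f : V → ℚ) :
    ∑ v, ∑ u ∈ B v, (f v + f u) = 2 * ∑ v, (B v).card * f v := by
  simp only [sum_add_distrib]
  rw [sum_sum_comm_of_symm hB fun _ u => f u, ← two_mul]
  simp only [sum_const, nsmul_eq_mul]

/-- A bilinear form in the choice distributions of the nodes. -/
def pairing (B : V → Finset V) (p : ℕ) (w : V → V → ℕ → ℚ) (g h : V → ℕ → ℚ) : ℚ :=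
  ∑ v, ∑ u ∈ B v, ∑ i ∈ range p, g v i * h u i * w v u i

/-- If no two neighbours change their distributions at the same time and no change increases the
expectation that concerns its node, then the total expectation does not increase. -/
theorem pairing_le_of_independent (hB : ∀ {v u}, u ∈ B v → v ∈ B u) {p : ℕ}
    {w : V → V → ℕ → ℚ} (hw : ∀ v u i, w v u i = w u v i) {g g' : V → ℕ → ℚ}
    (hind : ∀ v, ∀ u ∈ B v, g' v = g v ∨ g' u = g u)
    (hle : ∀ v, ∑ i ∈ range p, g' v i * ∑ u ∈ B v, g u i * w v u i
      ≤ ∑ i ∈ range p, g v i * ∑ u ∈ B v, g u i * w v u i) :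
    pairing B p w g' g' ≤ pairing B p w g g := by
  have hsymm : pairing B p w g g' = pairing B p w g' g := by
    rw [pairing, sum_sum_comm_of_symm hB, pairing]
    refine sum_congr rfl fun v _ => sum_congr rfl fun u _ => sum_congr rfl fun i _ => ?_
    rw [hw u v i]
    ring
  -- On every edge one endpoint is unchanged, so `(g' v i - g v i) * (g' u i - g u i) = 0`.
  have hexp : pairing B p w g' g' =
      pairing B p w g' g + pairing B p w g g' - pairing B p w g g := by
    simp only [pairing, ← sum_add_distrib, ← sum_sub_distrib]
    refine sum_congr rfl fun v _ => sum_congr rfl fun u hu => sum_congr rfl fun i _ => ?_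
    rcases hind v u hu with h | h <;> rw [h] <;> ring
  have hrow : ∀ h : V → ℕ → ℚ, pairing B p w h g
      = ∑ v, ∑ i ∈ range p, h v i * ∑ u ∈ B v, g u i * w v u i := by
    intro h
    refine sum_congr rfl fun v _ => ?_
    rw [sum_comm]
    refine sum_congr rfl fun i _ => ?_
    rw [mul_sum]
    exact sum_congr rfl fun u _ => by ring
  have hmono : pairing B p w g' g ≤ pairing B p w g g := by
    rw [hrow, hrow]
    exact sum_le_sum fun v _ => hle v
  linarith

/-- The distribution of the choice of a node with weights `a`: proportional to the weights if the
choice `j` is still open (`j = 0`), and concentrated in `i` if `j = i + 1`. -/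
def choiceDist (p : ℕ) (a : ℕ → ℕ) (j i : ℕ) : ℚ :=
  if j = 0 then (a i : ℚ) / ∑ i ∈ range p, (a i : ℚ) else if j = i + 1 then 1 else 0

/-- A choice that is open or has positive weight. -/
def ValidChoice (p : ℕ) (a : ℕ → ℕ) (j : ℕ) : Prop :=
  ∀ i, j = i + 1 → i < p ∧ a i ≠ 0

variable {p : ℕ}

theorem sum_choiceDist_succ_mul (a : ℕ → ℕ) (f : ℕ → ℚ) {i : ℕ} (hi : i < p) :
    ∑ k ∈ range p, choiceDist p a (i + 1) k * f k = f i := by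
  simp [choiceDist, ite_mul, hi]

/-- An average is at least the minimum over its support. Hence replacing an open choice by a
minimizer does not raise the conditional expectation. -/
theorem le_sum_choiceDist_mul {a : ℕ → ℕ} (ha : ∑ i ∈ range p, (a i : ℚ) ≠ 0) {j : ℕ}
    (hj : ValidChoice p a j) {f : ℕ → ℚ} {b : ℚ} (hf : ∀ i < p, a i ≠ 0 → b ≤ f i) :
    b ≤ ∑ i ∈ range p, choiceDist p a j i * f i := by
  rcases j with _ | j
  · have hA : 0 < ∑ i ∈ range p, (a i : ℚ) :=
      lt_of_le_of_ne (sum_nonneg fun _ _ => Nat.cast_nonneg _) ha.symm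
    have h1 : ∑ i ∈ range p, choiceDist p a 0 i * b = b := by
      simp only [choiceDist, if_true]
      rw [← sum_mul, ← sum_div, div_self ha, one_mul]
    rw [← h1]
    refine sum_le_sum fun i hi => ?_
    by_cases h0 : a i = 0
    · simp [choiceDist, h0]
    · refine mul_le_mul_of_nonneg_left (hf i (mem_range.1 hi) h0) ?_
      simp only [choiceDist, if_true]
      positivity
  · rw [sum_choiceDist_succ_mul a f (hj j rfl).1]
    exact hf j (hj j rfl).1 (hj j rfl).2

/-- The penalty for two neighbours with weights `a` and `b` that both choose `i`. -/
def penalty (a b : ℕ → ℕ) (i : ℕ) : ℚ := 1 / a i + 1 / b i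

/-- The penalty is made for this cancellation: with totals `A` and `D`, the probability `a i * b i /
(A * D)` times the penalty is `(a i + b i) / (A * D)`. Only terms with a zero weight make it an
inequality. -/
theorem sum_choiceDist_zero_le {a b : ℕ → ℕ} (ha : ∑ i ∈ range p, (a i : ℚ) ≠ 0)
    (hb : ∑ i ∈ range p, (b i : ℚ) ≠ 0) :
    ∑ i ∈ range p, choiceDist p a 0 i * choiceDist p b 0 i * penalty a b i
      ≤ 1 / ∑ i ∈ range p, (a i : ℚ) + 1 / ∑ i ∈ range p, (b i : ℚ) := by
  set A := ∑ i ∈ range p, (a i : ℚ) with hA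
  set D := ∑ i ∈ range p, (b i : ℚ) with hD
  have hA0 : 0 ≤ A := sum_nonneg fun _ _ => Nat.cast_nonneg _
  have hD0 : 0 ≤ D := sum_nonneg fun _ _ => Nat.cast_nonneg _
  have hsum : ∑ i ∈ range p, ((b i : ℚ) + a i) / (A * D) = 1 / A + 1 / D := by
    rw [← sum_div, sum_add_distrib, ← hA, ← hD]
    field_simp
  rw [← hsum]
  refine sum_le_sum fun i _ => ?_
  simp only [choiceDist, if_true, penalty, ← hA, ← hD]
  by_cases h1 : a i = 0
  · simp only [h1, Nat.cast_zero, zero_div, zero_mul]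
    positivity
  by_cases h2 : b i = 0
  · simp only [h2, Nat.cast_zero, zero_div, zero_mul, mul_zero]
    positivity
  have h1' : (a i : ℚ) ≠ 0 := by exact_mod_cast h1
  have h2' : (b i : ℚ) ≠ 0 := by exact_mod_cast h2
  refine le_of_eq ?_
  field_simp

theorem sum_choiceDist_succ {a b : ℕ → ℕ} {i j : ℕ} (hi : i < p) :
    ∑ k ∈ range p, choiceDist p a (i + 1) k * choiceDist p b (j + 1) k * penalty a b k
      = if j + 1 = i + 1 then (1 / a i : ℚ) + 1 / b j else 0 := by
  simp only [mul_assoc]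
  rw [sum_choiceDist_succ_mul a (fun k => choiceDist p b (j + 1) k * penalty a b k) hi]
  by_cases h : j = i
  · subst h; simp [choiceDist, penalty]
  · simp [choiceDist, h]

/-- The size of part `i` of the list `L`, or zero if the part is small compared with the list. -/
def partWeight (p : ℕ) (part : ℕ → ℕ) (L : Finset ℕ) (i : ℕ) : ℕ :=
  if L.card ≤ 2 * p * (L.filter fun x => part x = i).card
  then (L.filter fun x => part x = i).card else 0

/-- Each discarded part is smaller than `L.card / (2 * p)`, so the `p` parts lose at most half of
the list. -/
theorem card_le_two_mul_sum_partWeight (hp : p ≠ 0) {part : ℕ → ℕ} (hpart : ∀ x, part x < p)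
    (L : Finset ℕ) : L.card ≤ 2 * ∑ i ∈ range p, partWeight p part L i := by
  have h1 : L.card = ∑ i ∈ range p, (L.filter fun x => part x = i).card :=
    card_eq_sum_card_fiberwise fun x _ => by simpa using hpart x
  have h2 : ∑ i ∈ range p, 2 * p * (L.filter fun x => part x = i).card
      ≤ ∑ i ∈ range p, (2 * p * partWeight p part L i + L.card) := by
    refine sum_le_sum fun i _ => ?_
    rw [partWeight]
    split_ifs with h <;> omega
  rw [← mul_sum, ← h1, sum_add_distrib, ← mul_sum, sum_const, card_range, smul_eq_mul] at h2
  refine Nat.le_of_mul_le_mul_left (?_ : p * L.card ≤ p * _) (Nat.pos_of_ne_zero hp)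
  nlinarith

theorem partWeight_le (p : ℕ) (part : ℕ → ℕ) (L : Finset ℕ) (i : ℕ) :
    partWeight p part L i ≤ L.card := by
  rw [partWeight]
  split_ifs
  · exact card_filter_le _ _
  · exact Nat.zero_le _

/-- The sum of the conflict degrees divided by the list sizes. -/
def conflictRatio (H : V → Finset V) (L : V → Finset ℕ) : ℚ :=
  ∑ v, ((H v).card : ℚ) / (L v).card

/-- A choice of parts that does not increase the expectation given by the bichromatic edges, for a
coloring `ψ` with few monochromatic edges, at most triples the conflict ratio. -/
theorem conflictRatio_split_le {H : V → Finset V} (hH : ∀ {v u}, u ∈ H v → v ∈ H u)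
    {L : V → Finset ℕ} (hL : ∀ v, (L v).Nonempty) (hp : p ≠ 0) {part : ℕ → ℕ}
    (hpart : ∀ x, part x < p) {ψ : V → ℕ}
    (hψ : ∀ v, 2 * p * ((H v).filter fun u => ψ u = ψ v).card ≤ (H v).card) {j : V → ℕ}
    (hj0 : ∀ v, j v ≠ 0) (hj : ∀ v, ValidChoice p (partWeight p part (L v)) (j v))
    (hE : let W := pairing (fun v => (H v).filter fun u => ψ u ≠ ψ v) p
            fun v u => penalty (partWeight p part (L v)) (partWeight p part (L u))
          let g := fun (j : V → ℕ) v => choiceDist p (partWeight p part (L v)) (j v)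
          W (g j) (g j) ≤ W (g fun _ => 0) (g fun _ => 0)) :
    conflictRatio (fun v => (H v).filter fun u => j u = j v)
      (fun v => (L v).filter fun x => part x + 1 = j v) ≤ 3 * conflictRatio H L := by
  choose i hi using fun v => Nat.exists_eq_succ_of_ne_zero (hj0 v)
  obtain rfl : j = fun v => i v + 1 := funext hi
  have hip : ∀ v, i v < p := fun v => (hj v _ rfl).1
  set a : V → ℕ → ℕ := fun v => partWeight p part (L v) with ha
  set B : V → Finset V := fun v => (H v).filter fun u => ψ u ≠ ψ v with hBdef
  have hB : ∀ {v u}, u ∈ B v → v ∈ B u := fun {v u} h => by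
    simp only [hBdef, mem_filter] at h ⊢
    exact ⟨hH h.1, h.2.symm⟩
  have hLpos : ∀ v, (0 : ℚ) < (L v).card := fun v => by exact_mod_cast (hL v).card_pos
  have hA : ∀ v, ((L v).card : ℚ) ≤ 2 * ∑ k ∈ range p, (a v k : ℚ) := fun v => by
    exact_mod_cast card_le_two_mul_sum_partWeight hp hpart (L v)
  have hA0 : ∀ v, 0 < ∑ k ∈ range p, (a v k : ℚ) := fun v => by
    have := hA v; have := hLpos v; linarith
  have hcard : ∀ v, a v (i v) = ((L v).filter fun x => part x = i v).card ∧
      (L v).card ≤ 2 * p * a v (i v) := by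
    intro v
    have h := (hj v _ rfl).2
    by_cases h' : (L v).card ≤ 2 * p * ((L v).filter fun x => part x = i v).card
    · have h1 : a v (i v) = ((L v).filter fun x => part x = i v).card := if_pos h'
      exact ⟨h1, h1 ▸ h'⟩
    · exact absurd (if_neg h') h
  have hapos : ∀ v, (0 : ℚ) < a v (i v) := fun v => by
    exact_mod_cast Nat.pos_of_ne_zero (hj v _ rfl).2
  -- the initial expectation
  have hinit : pairing B p (fun v u => penalty (a v) (a u))
      (fun v => choiceDist p (a v) 0) (fun v => choiceDist p (a v) 0)
      ≤ 4 * conflictRatio H L := by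
    calc _ ≤ ∑ v, ∑ u ∈ B v, (1 / ∑ k ∈ range p, (a v k : ℚ) + 1 / ∑ k ∈ range p, (a u k : ℚ)) :=
          sum_le_sum fun v _ => sum_le_sum fun u _ =>
            sum_choiceDist_zero_le (hA0 v).ne' (hA0 u).ne'
      _ = 2 * ∑ v, (B v).card * (1 / ∑ k ∈ range p, (a v k : ℚ)) := sum_sum_add_of_symm hB _
      _ ≤ 2 * ∑ v, 2 * (((H v).card : ℚ) / (L v).card) := by
          refine mul_le_mul_of_nonneg_left (sum_le_sum fun v _ => ?_) two_pos.le
          have h1 : ((B v).card : ℚ) ≤ (H v).card := by exact_mod_cast card_filter_le _ _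
          have h2 : 1 / ∑ k ∈ range p, (a v k : ℚ) ≤ 2 / (L v).card := by
            rw [div_le_div_iff₀ (hA0 v) (hLpos v)]
            linarith [hA v]
          calc _ ≤ ((H v).card : ℚ) * (2 / (L v).card) :=
                mul_le_mul h1 h2 (by have := hA0 v; positivity) (by positivity)
            _ = _ := by ring
      _ = 4 * conflictRatio H L := by rw [← mul_sum, conflictRatio]; ring
  -- the final expectation
  have hfinal : pairing B p (fun v u => penalty (a v) (a u))
      (fun v => choiceDist p (a v) (i v + 1)) (fun v => choiceDist p (a v) (i v + 1))
      = 2 * ∑ v, ((B v).filter fun u => i u + 1 = i v + 1).card * (1 / a v (i v) : ℚ) := by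
    rw [← sum_sum_add_of_symm (B := fun v => (B v).filter fun u => i u + 1 = i v + 1)]
    · refine sum_congr rfl fun v _ => ?_
      rw [sum_filter (fun u => i u + 1 = i v + 1)]
      exact sum_congr rfl fun u _ => sum_choiceDist_succ (hip v)
    · intro v u h
      simp only [mem_filter] at h ⊢
      exact ⟨hB h.1, h.2.symm⟩
  have hW : 2 * ∑ v, ((B v).filter fun u => i u + 1 = i v + 1).card * (1 / a v (i v) : ℚ)
      ≤ 4 * conflictRatio H L := by
    rw [← hfinal]
    exact le_trans hE hinit
  -- By `hW` the bichromatic edges account for at most twice the old ratio; the monochromatic ones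
  -- add at most the old ratio once more.
  have hsplit : conflictRatio (fun v => (H v).filter fun u => i u + 1 = i v + 1)
      (fun v => (L v).filter fun x => part x + 1 = i v + 1)
      ≤ ∑ v, (((B v).filter fun u => i u + 1 = i v + 1).card * (1 / a v (i v) : ℚ)
        + ((H v).card : ℚ) / (L v).card) := by
    refine sum_le_sum fun v _ => ?_
    have h1 : ((L v).filter fun x => part x + 1 = i v + 1).card = a v (i v) := by
      rw [(hcard v).1]; simp
    classical
    have h2 : ((H v).filter fun u => i u + 1 = i v + 1).card
        ≤ ((B v).filter fun u => i u + 1 = i v + 1).card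
          + ((H v).filter fun u => ψ u = ψ v).card := by
      refine (card_le_card fun u hu => ?_).trans (card_union_le _ _)
      simp only [hBdef, mem_union, mem_filter] at hu ⊢
      tauto
    have h2' : (((H v).filter fun u => i u + 1 = i v + 1).card : ℚ)
        ≤ ((B v).filter fun u => i u + 1 = i v + 1).card
          + ((H v).filter fun u => ψ u = ψ v).card := by exact_mod_cast h2
    -- At most a `1 / (2 * p)` fraction of the edges is monochromatic, and small parts were
    -- discarded so that the list shrinks by a factor of at most `2 * p`.
    have h3 : (((H v).filter fun u => ψ u = ψ v).card : ℚ) / a v (i v)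
        ≤ ((H v).card : ℚ) / (L v).card := by
      rw [div_le_div_iff₀ (hapos v) (hLpos v)]
      have h4 : (((H v).filter fun u => ψ u = ψ v).card : ℚ) * (L v).card
          ≤ ((H v).filter fun u => ψ u = ψ v).card * (2 * p * a v (i v)) :=
        mul_le_mul_of_nonneg_left (by exact_mod_cast (hcard v).2) (by positivity)
      have h5 : (2 * p * ((H v).filter fun u => ψ u = ψ v).card : ℚ) * a v (i v)
          ≤ (H v).card * a v (i v) :=
        mul_le_mul_of_nonneg_right (by exact_mod_cast hψ v) (hapos v).le
      linarith
    rw [h1]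
    calc _ ≤ ((((B v).filter fun u => i u + 1 = i v + 1).card : ℚ)
          + ((H v).filter fun u => ψ u = ψ v).card) / a v (i v) :=
          div_le_div_of_nonneg_right h2' (hapos v).le
      _ ≤ _ := by rw [add_div, mul_one_div]; linarith
  rw [sum_add_distrib] at hsplit
  have : ∑ v, ((H v).card : ℚ) / (L v).card = conflictRatio H L := rfl
  linarith

end ConditionalExpectation

/-! ### The distributed splitting step. -/

section

variable {V : Type*} [Fintype V] {G : SimpleGraph V} [DecidableRel G.Adj] {ident : V → ℕ} {M : ℕ}

theorem Runs.cast {α : Type} {s t : ℕ} {π : V → Prog α} {Q : (V → α) → Prop}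
    (h : Runs G ident M s π Q) (hst : s = t) : Runs G ident M t π Q := hst ▸ h

namespace Prog

/-- Broadcast the numbers `a 0, …, a (p - 1)` and return the table of what was received. -/
def gather (p : ℕ) (a : ℕ → ℕ) : Prog (ℕ → ℕ → ℕ) :=
  iter p (fun k tbl => (exchange (a k)).bind fun r => ret (Function.update tbl k r)) fun _ _ => 0

theorem runs_gather {p : ℕ} {a : V → ℕ → ℕ} (ha : ∀ v, ∀ k < p, a v k < M) :
    Runs G ident M p (fun v => gather p (a v)) fun (tbl : V → ℕ → ℕ → ℕ) =>
      ∀ v, ∀ k < p, tbl v k = inbox G ident (fun u => a u k) v := by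
  have h := Runs.iter (G := G) (ident := ident) (M := M)
    (f := fun v k tbl => (exchange (a v k)).bind fun r => ret (Function.update tbl k r))
    (y := fun _ _ _ => 0) (τ := 0 + 1)
    (fun n (tbl : V → ℕ → ℕ → ℕ) =>
      ∀ v, ∀ k < n, tbl v k = inbox G ident (fun u => a u k) v) p
    (fun n hn tbl htbl => Runs.exchange_bind (fun v => ha v n hn) (Runs.ret fun v k hk => ?_))
    (fun v k hk => absurd hk (Nat.not_lt_zero k))
  · exact h.cast (by simp)
  · rcases Nat.lt_succ_iff_lt_or_eq.1 hk with h | rfl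
    · rw [Function.update_of_ne h.ne]
      exact htbl v k h
    · rw [Function.update_self]

/-- The part that minimizes the conditional expectation of the penalties with the neighbours in
`N` of other colors, given the colors `rψ`, the weights `ra` and the choices `rj` of these. -/
noncomputable def bestPart (p : ℕ) (a : ℕ → ℕ) (N : Finset ℕ) (ψ : ℕ) (rψ : ℕ → ℕ)
    (ra : ℕ → ℕ → ℕ) (rj : ℕ → ℕ) : ℕ :=
  argminOn ((Finset.range p).filter fun i => a i ≠ 0) fun i =>
    ∑ u ∈ N.filter fun u => rψ u ≠ ψ,
      choiceDist p (fun k => ra k u) (rj u) i * penalty a (fun k => ra k u) i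

/-- Choose a part of the own list, color class by color class of a coloring with few monochromatic
edges; keep the neighbours with the same choice and the chosen part of the list. -/
noncomputable def split (F : HashFamily) (p : ℕ) (part : ℕ → ℕ) (c : ℕ)
    (S : Finset ℕ × Finset ℕ) : Prog (Finset ℕ × Finset ℕ) :=
  (recolor F c S.1).bind fun ψ =>
  (exchange ψ).bind fun rψ =>
  (gather p (partWeight p part S.2)).bind fun ra =>
  (iter (F.size * F.size) (fun k j => (exchange j).bind fun rj =>
    ret (if ψ = k then bestPart p (partWeight p part S.2) S.1 ψ rψ ra rj + 1 else j)) 0).bind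
    fun j =>
  (exchange j).bind fun rj =>
  ret (S.1.filter fun i => rj i = j, S.2.filter fun x => part x + 1 = j)

theorem choiceDist_congr {p : ℕ} {a b : ℕ → ℕ} (h : ∀ k < p, a k = b k) (j : ℕ) {i : ℕ}
    (hi : i < p) : choiceDist p a j i = choiceDist p b j i := by
  have : ∑ k ∈ Finset.range p, (a k : ℚ) = ∑ k ∈ Finset.range p, (b k : ℚ) :=
    Finset.sum_congr rfl fun k hk => by rw [h k (Finset.mem_range.1 hk)]
  simp only [choiceDist, h i hi, this]

/-- The quantity minimized from received numbers is the conditional expectation over bichromatic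
neighbors; the received weights are known only for indices below `p`, which is all it uses. -/
theorem bestPart_spec (hid : Function.Injective ident) {p : ℕ} {a : V → ℕ → ℕ}
    (ha : ∀ v, ∑ i ∈ Finset.range p, (a v i : ℚ) ≠ 0) {H : V → Finset V}
    (hH : IsSubnetwork G H) (ψ j : V → ℕ) {ra : V → ℕ → ℕ → ℕ}
    (hra : ∀ v, ∀ k < p, ra v k = inbox G ident (fun u => a u k) v) (v : V) :
    ∃ i₀, bestPart p (a v) ((H v).image ident) (ψ v) (inbox G ident ψ v) (ra v)
      (inbox G ident j v) = i₀ ∧ i₀ < p ∧ a v i₀ ≠ 0 ∧ ∀ i < p, a v i ≠ 0 →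
      ∑ u ∈ (H v).filter fun u => ψ u ≠ ψ v,
          choiceDist p (a u) (j u) i₀ * penalty (a v) (a u) i₀
        ≤ ∑ u ∈ (H v).filter fun u => ψ u ≠ ψ v,
          choiceDist p (a u) (j u) i * penalty (a v) (a u) i := by
  have hcost : ∀ i < p, ∑ u ∈ ((H v).image ident).filter fun u => inbox G ident ψ v u ≠ ψ v,
      choiceDist p (fun k => ra v k u) (inbox G ident j v u) i
        * penalty (a v) (fun k => ra v k u) i
      = ∑ u ∈ (H v).filter fun u => ψ u ≠ ψ v,
          choiceDist p (a u) (j u) i * penalty (a v) (a u) i := by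
    intro i hi
    rw [filter_image_ident _ (fun u => ψ u ≠ ψ v),
      Finset.sum_image fun _ _ _ _ h => hid h]
    · refine Finset.sum_congr rfl fun u hu => ?_
      have hvu := hH.adj (Finset.mem_filter.1 hu).1
      have hr : ∀ k < p, ra v k (ident u) = a u k := fun k hk => by
        rw [hra v k hk, inbox_apply hid _ hvu]
      rw [inbox_apply hid _ hvu, choiceDist_congr hr _ hi]
      simp only [penalty, hr i hi]
    · intro u hu
      rw [inbox_apply hid _ (hH.adj hu)]
  have hne : ((Finset.range p).filter fun i => a v i ≠ 0).Nonempty := by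
    obtain ⟨i, hi, h⟩ := Finset.exists_ne_zero_of_sum_ne_zero (ha v)
    exact ⟨i, Finset.mem_filter.2 ⟨hi, by exact_mod_cast h⟩⟩
  have hmem := argminOn_mem hne fun i =>
    ∑ u ∈ ((H v).image ident).filter fun u => inbox G ident ψ v u ≠ ψ v,
      choiceDist p (fun k => ra v k u) (inbox G ident j v u) i
        * penalty (a v) (fun k => ra v k u) i
  rw [Finset.mem_filter, Finset.mem_range] at hmem
  refine ⟨argminOn _ _, rfl, hmem.1, hmem.2, fun i hi hai => ?_⟩
  rw [← hcost i hi, ← hcost _ hmem.1]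
  exact apply_argminOn_le (fun i =>
    ∑ u ∈ ((H v).image ident).filter fun u => inbox G ident ψ v u ≠ ψ v,
      choiceDist p (fun k => ra v k u) (inbox G ident j v u) i
        * penalty (a v) (fun k => ra v k u) i)
    (Finset.mem_filter.2 ⟨Finset.mem_range.2 hi, hai⟩)

/-- The color classes of `ψ` choose in turn. Bichromatic edges never have both endpoints active, so
`pairing_le_of_independent` applies to each turn; `2 * p * d ≤ k < F.size` makes monochromatic edges
rare enough for `conflictRatio_split_le`. -/
theorem runs_split (hid : Function.Injective ident) {F : HashFamily} {m d k p : ℕ}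
    (hF : F.Good m d k) (hk : 2 * p * d ≤ k) (hp : p ≠ 0) {part : ℕ → ℕ}
    (hpart : ∀ x, part x < p) {c : V → ℕ} (hcm : ∀ v, c v < m)
    {H : V → Finset V} (hH : IsSubnetwork G H) (hc : ∀ v, ∀ u ∈ H v, c u ≠ c v)
    {L : V → Finset ℕ} (hL : ∀ v, (L v).Nonempty)
    (hmM : m ≤ M) (hFM : F.size * F.size ≤ M) (hpM : p < M) (hLM : ∀ v, (L v).card < M) :
    Runs G ident M (F.size * F.size + p + 3)
      (fun v => split F p part (c v) ((H v).image ident, L v)) fun S =>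
        ∃ H' : V → Finset V, IsSubnetwork G H' ∧ (∀ v, H' v ⊆ H v) ∧
          (∀ v, (S v).1 = (H' v).image ident) ∧ (∀ v, (S v).2 ⊆ L v) ∧
          (∀ v, (S v).2.Nonempty) ∧ (∀ v, ∀ x ∈ (S v).2, ∀ y ∈ (S v).2, part x = part y) ∧
          (∀ v, ∀ u ∈ H v, ∀ x ∈ (S v).2, x ∈ (S u).2 → u ∈ H' v) ∧
          conflictRatio H' (fun v => (S v).2) ≤ 3 * conflictRatio H L := by
  set a : V → ℕ → ℕ := fun v => partWeight p part (L v) with ha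
  have hApos : ∀ v, ∑ i ∈ Finset.range p, (a v i : ℚ) ≠ 0 := fun v => by
    have h1 := card_le_two_mul_sum_partWeight hp hpart (L v)
    have h2 := (hL v).card_pos
    have h3 : ∑ i ∈ Finset.range p, a v i ≠ 0 := by simp only [ha]; omega
    exact_mod_cast h3
  have hrounds : 0 + 1 + F.size * F.size * (0 + 1) + p + 1 + 1 = F.size * F.size + p + 3 := by
    ring
  refine Runs.cast (Runs.bind (runs_recolor hid hF hH hcm (fun v => (hcm v).trans_le hmM) hc)
    fun ψ hψ => ?_) hrounds
  have hψ2 : ∀ v, 2 * p * ((H v).filter fun u => ψ u = ψ v).card ≤ (H v).card := by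
    intro v
    -- For `d = 0` the factor `d` cannot be cancelled, but then there are no monochromatic edges at
    -- all.
    rcases Nat.eq_zero_or_pos d with rfl | hd
    · have h1 := hψ.2 v
      have h2 := hF.lt_size
      have h3 : ((H v).filter fun u => ψ u = ψ v).card = 0 := by
        rw [Nat.zero_mul, Nat.le_zero, Nat.mul_eq_zero] at h1
        exact h1.resolve_left (by omega)
      rw [h3]
      exact Nat.zero_le _
    · refine Nat.le_of_mul_le_mul_left (?_ : d * _ ≤ d * _) hd
      calc d * (2 * p * ((H v).filter fun u => ψ u = ψ v).card)
          = 2 * p * d * ((H v).filter fun u => ψ u = ψ v).card := by ring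
        _ ≤ F.size * ((H v).filter fun u => ψ u = ψ v).card :=
          Nat.mul_le_mul_right _ (hk.trans hF.lt_size.le)
        _ ≤ d * (H v).card := hψ.2 v
  refine Runs.exchange_bind (fun v => (hψ.1 v).trans_le hFM) ?_
  refine Runs.bind (runs_gather fun v i _ => (partWeight_le p part (L v) i).trans_lt (hLM v))
    fun ra hra => ?_
  have hjM : ∀ j : V → ℕ, (∀ v, ValidChoice p (a v) (j v)) → ∀ v, j v < M := by
    intro j hj v
    rcases hjv : j v with _ | i
    · omega
    · have := (hj v i hjv).1
      omega
  refine Runs.bind (Runs.iter (fun n j =>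
      (∀ v, ValidChoice p (a v) (j v)) ∧ (∀ v, ψ v < n → j v ≠ 0) ∧
      let W := pairing (fun v => (H v).filter fun u => ψ u ≠ ψ v) p fun v u => penalty (a v) (a u)
      let g := fun (j : V → ℕ) v => choiceDist p (a v) (j v)
      W (g j) (g j) ≤ W (g fun _ => 0) (g fun _ => 0)) (F.size * F.size)
      (fun n hn j hj => ?_)
      ⟨fun v i h => by simp at h, fun v h => absurd h (Nat.not_lt_zero _), le_rfl⟩)
    fun j hj => ?_
  · refine Runs.exchange_bind (hjM j hj.1) (Runs.ret ?_)
    choose i₀ hi₀ hi₀p hai₀ hmin using bestPart_spec hid hApos hH ψ j hra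
    simp only [ha] at hi₀
    simp only [hi₀]
    refine ⟨fun v i hi => ?_, fun v hv => ?_, le_trans ?_ hj.2.2⟩
    · split_ifs at hi with h
      · obtain rfl := Nat.succ_injective hi
        exact ⟨hi₀p v, hai₀ v⟩
      · exact hj.1 v i hi
    · split_ifs with h
      · exact Nat.succ_ne_zero _
      · exact hj.2.1 v (by omega)
    · refine pairing_le_of_independent ?_ (fun v u i => add_comm _ _) (fun v u hu => ?_)
        (fun v => ?_)
      · intro v u h
        simp only [Finset.mem_filter] at h ⊢
        exact ⟨hH.symm h.1, h.2.symm⟩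
      · by_cases hv : ψ v = n
        · right
          have hu' : ψ u ≠ n := hv ▸ (Finset.mem_filter.1 hu).2
          rw [if_neg hu']
        · left
          rw [if_neg hv]
      · by_cases hv : ψ v = n
        · rw [if_pos hv, sum_choiceDist_succ_mul _ _ (hi₀p v)]
          exact le_sum_choiceDist_mul (hApos v) (hj.1 v) (hmin v)
        · rw [if_neg hv]
  · refine Runs.exchange_bind (hjM j hj.1) (Runs.ret ?_)
    have hj0 : ∀ v, j v ≠ 0 := fun v => hj.2.1 v (hψ.1 v)
    refine ⟨fun v => (H v).filter fun u => j u = j v, ⟨fun h => hH.adj (Finset.mem_filter.1 h).1,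
      fun h => ?_⟩, fun v => Finset.filter_subset _ _, fun v => filter_image_ident _ _ fun u hu => ?_,
      fun v => Finset.filter_subset _ _, fun v => ?_, fun v x hx y hy => ?_,
      fun v u hu x hx hxu => ?_,
      conflictRatio_split_le hH.symm hL hp hpart hψ2 hj0 hj.1 hj.2.2⟩
    · simp only [Finset.mem_filter] at h ⊢
      exact ⟨hH.symm h.1, h.2.symm⟩
    · rw [inbox_apply hid _ (hH.adj hu)]
    · obtain ⟨i, hi⟩ := Nat.exists_eq_succ_of_ne_zero (hj0 v)
      have h := (hj.1 v i hi).2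
      simp only [ha, partWeight] at h
      split_ifs at h with h'
      · obtain ⟨x, hx⟩ := Finset.card_ne_zero.1 h
        rw [Finset.mem_filter] at hx
        exact ⟨x, Finset.mem_filter.2 ⟨hx.1, by rw [hi, hx.2]⟩⟩
      · exact absurd rfl h
    · have h1 := (Finset.mem_filter.1 hx).2
      have h2 := (Finset.mem_filter.1 hy).2
      omega
    · have h1 := (Finset.mem_filter.1 hx).2
      have h2 := (Finset.mem_filter.1 hxu).2
      exact Finset.mem_filter.2 ⟨hu, h2.symm.trans h1⟩

end Prog

end

/-! ### Candidate colors digit by digit, and independent sets. -/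

section

variable {V : Type*} [Fintype V] {G : SimpleGraph V} [DecidableRel G.Adj] {ident : V → ℕ} {M : ℕ}

namespace Prog

/-- Choose the digits in base `p` of a color one after the other. -/
noncomputable def splitDigits (F : HashFamily) (p ℓ c : ℕ) (S : Finset ℕ × Finset ℕ) :
    Prog (Finset ℕ × Finset ℕ) :=
  iter ℓ (fun i => split F p (fun x => x / p ^ i % p) c) S

/-- After `n` digits the colors left in a list agree modulo `p ^ n`, so `ℓ` digits leave a single
color and the conflict ratio becomes the total degree. Edges whose endpoints still share a color are
never dropped. -/
theorem runs_splitDigits (hid : Function.Injective ident) {F : HashFamily} {m d k p : ℕ}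
    (hF : F.Good m d k) (hk : 2 * p * d ≤ k) (hp : p ≠ 0) {c : V → ℕ} (hcm : ∀ v, c v < m)
    (hcG : ∀ v u, G.Adj v u → c u ≠ c v) {H : V → Finset V} (hH : IsSubnetwork G H)
    {L : V → Finset ℕ} (hL : ∀ v, (L v).Nonempty) {ℓ : ℕ} (hLp : ∀ v, ∀ x ∈ L v, x < p ^ ℓ)
    (hmM : m ≤ M) (hFM : F.size * F.size ≤ M) (hpM : p < M) (hLM : ∀ v, (L v).card < M) :
    Runs G ident M (ℓ * (F.size * F.size + p + 3))
      (fun v => splitDigits F p ℓ (c v) ((H v).image ident, L v)) fun S =>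
        ∃ H' : V → Finset V, IsSubnetwork G H' ∧ (∀ v, H' v ⊆ H v) ∧
          (∀ v, (S v).1 = (H' v).image ident) ∧
          (∀ v, ∃ x ∈ L v, (S v).2 = {x}) ∧
          (∀ v, ∀ u ∈ H v, (S u).2 = (S v).2 → u ∈ H' v) ∧
          ((∑ v, (H' v).card : ℕ) : ℚ) ≤ 3 ^ ℓ * conflictRatio H L := by
  refine (Runs.iter (fun n (S : V → Finset ℕ × Finset ℕ) =>
    ∃ H' : V → Finset V, IsSubnetwork G H' ∧ (∀ v, H' v ⊆ H v) ∧
      (∀ v, (S v).1 = (H' v).image ident) ∧ (∀ v, (S v).2 ⊆ L v) ∧ (∀ v, (S v).2.Nonempty) ∧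
      (∀ v, ∀ x ∈ (S v).2, ∀ y ∈ (S v).2, x % p ^ n = y % p ^ n) ∧
      (∀ v, ∀ u ∈ H v, ∀ x ∈ (S v).2, x ∈ (S u).2 → u ∈ H' v) ∧
      conflictRatio H' (fun v => (S v).2) ≤ 3 ^ n * conflictRatio H L) ℓ
    (fun n hn S hS => ?_) ?_).mono fun S hS => ?_
  · obtain ⟨H', hH', hsub, hS1, hSL, hSne, hdig, hconf, hratio⟩ := hS
    have hSeq : S = fun v => ((H' v).image ident, (S v).2) := funext fun v => by rw [← hS1]
    rw [hSeq]
    refine (runs_split hid hF hk hp (fun x => Nat.mod_lt _ (Nat.pos_of_ne_zero hp)) hcm hH'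
      (fun v u hu => hcG v u (hH'.adj hu)) hSne hmM hFM hpM
      (fun v => (Finset.card_le_card (hSL v)).trans_lt (hLM v))).mono fun T hT => ?_
    obtain ⟨K, hK, hKsub, hT1, hTL, hTne, hTdig, hTconf, hTratio⟩ := hT
    refine ⟨K, hK, fun v => (hKsub v).trans (hsub v), hT1, fun v => (hTL v).trans (hSL v), hTne,
      fun v x hx y hy => ?_, fun v u hu x hx hxu => ?_, hTratio.trans ?_⟩
    · rw [Nat.mod_pow_succ, Nat.mod_pow_succ, hdig v x (hTL v hx) y (hTL v hy),
        hTdig v x hx y hy]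
    · exact hTconf v u (hconf v u hu x (hTL v hx) (hTL u hxu)) x hx hxu
    · rw [pow_succ]
      linarith
  · exact ⟨H, hH, fun v => Finset.Subset.refl _, fun v => rfl, fun v => Finset.Subset.refl _, hL,
      fun v x _ y _ => by simp [Nat.mod_one], fun v u hu _ _ _ => hu, by simp⟩
  · obtain ⟨H', hH', hsub, hS1, hSL, hSne, hdig, hconf, hratio⟩ := hS
    have hone : ∀ v, ∃ x ∈ L v, (S v).2 = {x} := by
      intro v
      obtain ⟨x, hx⟩ := hSne v
      refine ⟨x, hSL v hx, Finset.eq_singleton_iff_unique_mem.2 ⟨hx, fun y hy => ?_⟩⟩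
      have := hdig v y hy x hx
      rwa [Nat.mod_eq_of_lt (hLp v y (hSL v hy)), Nat.mod_eq_of_lt (hLp v x (hSL v hx))] at this
    refine ⟨H', hH', hsub, hS1, hone, fun v u hu h => ?_, ?_⟩
    · obtain ⟨x, hx⟩ := hSne v
      exact hconf v u hu x hx (h ▸ hx)
    · refine le_trans (le_of_eq ?_) hratio
      rw [conflictRatio, Nat.cast_sum]
      refine Finset.sum_congr rfl fun v _ => ?_
      obtain ⟨x, _, hx⟩ := hone v
      simp [hx]

/-- Compute a maximal independent set of the nodes with at most `D` neighbours in `N`, color class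
by color class; the result is nonzero for the members. -/
noncomputable def join (F : HashFamily) (D c : ℕ) (N : Finset ℕ) : Prog ℕ :=
  (recolor F c N).bind fun ψ =>
    iter (F.size * F.size) (fun k j => (exchange j).bind fun r =>
      ret (if ψ = k ∧ N.card ≤ D ∧ ∀ i ∈ N, r i = 0 then 1 else j)) 0

/-- For a node with at most `D` neighbors the defect bound `d * D / F.size` is below one, so none of
its neighbors acts in its turn and the greedy choice is independent. -/
theorem runs_join (hid : Function.Injective ident) {F : HashFamily} {m d k D : ℕ}
    (hF : F.Good m d k) (hk : d * D ≤ k) {c : V → ℕ} (hcm : ∀ v, c v < m)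
    (hcG : ∀ v u, G.Adj v u → c u ≠ c v) {H : V → Finset V} (hH : IsSubnetwork G H)
    (hmM : m ≤ M) (h1M : 1 < M) :
    Runs G ident M (F.size * F.size + 1)
      (fun v => join F D (c v) ((H v).image ident)) fun j =>
        (∀ v, j v ≠ 0 → (H v).card ≤ D) ∧ (∀ v, ∀ u ∈ H v, j v ≠ 0 → j u = 0) ∧
        ∀ v, (H v).card ≤ D → j v ≠ 0 ∨ ∃ u ∈ H v, j u ≠ 0 := by
  have hrounds : F.size * F.size * (0 + 1) + 1 = F.size * F.size + 1 := by ring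
  refine Runs.cast (Runs.bind (runs_recolor hid hF hH hcm (fun v => (hcm v).trans_le hmM)
    fun v u hu => hcG v u (hH.adj hu)) fun ψ hψ => ?_) hrounds
  have hmono : ∀ v, (H v).card ≤ D → ∀ u ∈ H v, ψ u ≠ ψ v := by
    intro v hv u hu heq
    have h1 : 0 < ((H v).filter fun u => ψ u = ψ v).card :=
      Finset.card_pos.2 ⟨u, Finset.mem_filter.2 ⟨hu, heq⟩⟩
    have h2 := (Nat.le_mul_of_pos_right F.size h1).trans (hψ.2 v)
    have h3 := Nat.mul_le_mul_left d hv
    have := hF.lt_size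
    omega
  refine (Runs.iter (fun n j => (∀ v, j v ≤ 1) ∧ (∀ v, j v ≠ 0 → (H v).card ≤ D) ∧
    (∀ v, ∀ u ∈ H v, j v ≠ 0 → j u = 0) ∧
    ∀ v, ψ v < n → (H v).card ≤ D → j v ≠ 0 ∨ ∃ u ∈ H v, j u ≠ 0) (F.size * F.size)
    (fun n hn j hj => ?_)
    ⟨fun v => Nat.zero_le _, fun v h => absurd rfl h, fun v u _ _ => rfl,
      fun v h => absurd h (Nat.not_lt_zero _)⟩).mono fun j hj =>
        ⟨hj.2.1, hj.2.2.1, fun v => hj.2.2.2 v (hψ.1 v)⟩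
  obtain ⟨hj1, hjD, hind, hmax⟩ := hj
  refine Runs.exchange_bind (fun v => (hj1 v).trans_lt h1M) (Runs.ret ?_)
  have hall : ∀ v, (∀ i ∈ (H v).image ident, inbox G ident j v i = 0) ↔ ∀ u ∈ H v, j u = 0 := by
    intro v
    rw [Finset.forall_mem_image]
    exact forall₂_congr fun u hu => by rw [inbox_apply hid _ (hH.adj hu)]
  simp only [hall, Finset.card_image_of_injective _ hid]
  refine ⟨fun v => ?_, fun v h => ?_, fun v u hu h => ?_, fun v hv hD => ?_⟩
  · split_ifs
    exacts [le_rfl, hj1 v]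
  · split_ifs at h with hc
    exacts [hc.2.1, hjD v h]
  · split_ifs at h with hc
    · rw [if_neg fun hu' => hmono v hc.2.1 u hu (hu'.1.trans hc.1.symm)]
      exact hc.2.2 u hu
    · rw [if_neg fun hu' => h (hu'.2.2 v (hH.symm hu))]
      exact hind v u hu h
  · by_cases hvn : ψ v = n ∧ (H v).card ≤ D ∧ ∀ u ∈ H v, j u = 0
    · left
      rw [if_pos hvn]
      exact one_ne_zero
    · have hold : j v ≠ 0 ∨ ∃ u ∈ H v, j u ≠ 0 := by
        by_contra! hcon
        rcases Nat.lt_succ_iff_lt_or_eq.1 hv with h | h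
        · rcases hmax v h hD with h' | ⟨u, hu, h'⟩
          exacts [h' hcon.1, h' (hcon.2 u hu)]
        · exact hvn ⟨h, hD, hcon.2⟩
      rcases hold with h | ⟨u, hu, h⟩
      · left
        rwa [if_neg hvn]
      · right
        refine ⟨u, hu, ?_⟩
        split_ifs
        exacts [one_ne_zero, h]

end Prog

end

/-- A maximal independent set among the nodes of degree at most `D` contains a large part of a
network of small average degree. -/
theorem card_le_of_maximal_independent {V : Type*} [Fintype V] {G : SimpleGraph V} {H : V → Finset V} (hH : IsSubnetwork G H) {U : Finset V}
    (hU : ∀ v, H v ⊆ U) {b D : ℕ} (hb : b ≠ 0) (hbD : 2 * b ≤ D)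
    (hsum : ∑ v, (H v).card ≤ b * U.card) {j : V → ℕ} (hjD : ∀ v, j v ≠ 0 → (H v).card ≤ D)
    (hmax : ∀ v, (H v).card ≤ D → j v ≠ 0 ∨ ∃ u ∈ H v, j u ≠ 0) :
    U.card ≤ 2 * (D + 1) * (U.filter fun v => j v ≠ 0).card := by
  classical
  set J := U.filter fun v => j v ≠ 0 with hJ
  -- By maximality the closed neighborhoods of `J`, of at most `D + 1` nodes each, cover the nodes
  -- of low degree.
  have hA : (U.filter fun v => (H v).card ≤ D).card ≤ (D + 1) * J.card := by
    calc _ ≤ (J.biUnion fun u => insert u (H u)).card := by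
          refine Finset.card_le_card fun v hv => ?_
          rw [Finset.mem_filter] at hv
          rw [Finset.mem_biUnion]
          rcases hmax v hv.2 with h | ⟨u, hu, h⟩
          · exact ⟨v, Finset.mem_filter.2 ⟨hv.1, h⟩, Finset.mem_insert_self _ _⟩
          · exact ⟨u, Finset.mem_filter.2 ⟨hU v hu, h⟩, Finset.mem_insert_of_mem (hH.symm hu)⟩
      _ ≤ J.card * (D + 1) := Finset.card_biUnion_le_card_mul _ _ _ fun u hu =>
          (Finset.card_insert_le _ _).trans
            (Nat.succ_le_succ (hjD u (Finset.mem_filter.1 hu).2))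
      _ = _ := Nat.mul_comm _ _
  -- Markov's inequality: at most half of `U` has degree above `D ≥ 2 * b`.
  have hB : (U.filter fun v => ¬ (H v).card ≤ D).card * (2 * b) ≤ b * U.card := by
    calc _ = ∑ _v ∈ U.filter fun v => ¬ (H v).card ≤ D, 2 * b := by
          rw [Finset.sum_const, smul_eq_mul]
      _ ≤ ∑ v ∈ U.filter fun v => ¬ (H v).card ≤ D, (H v).card :=
          Finset.sum_le_sum fun v hv => by
            have := (Finset.mem_filter.1 hv).2
            omega
      _ ≤ ∑ v, (H v).card := Finset.sum_le_sum_of_subset (Finset.subset_univ _)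
      _ ≤ _ := hsum
  have hB' : 2 * (U.filter fun v => ¬ (H v).card ≤ D).card ≤ U.card :=
    Nat.le_of_mul_le_mul_left (by linarith : b * _ ≤ b * _) (Nat.pos_of_ne_zero hb)
  have hAB := Finset.card_filter_add_card_filter_not (s := U) fun v => (H v).card ≤ D
  linarith

/-! ### Coloring a fraction of the nodes, and iteration. -/

section

variable {V : Type*} [Fintype V] {G : SimpleGraph V} [DecidableRel G.Adj] {ident : V → ℕ} {M : ℕ}

/-- `col` is a proper coloring of some of the nodes with colors from their lists. -/
structure IsPartialColoring (G : SimpleGraph V) (L : V → Finset ℕ) (col : V → Option ℕ) :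
    Prop where
  mem : ∀ {v x}, col v = some x → x ∈ L v
  proper : ∀ {v u x}, G.Adj v u → col v = some x → col u ≠ some x

namespace Prog

/-- The available colors of a node with color `col`, list `L` and neighbours `N` that have sent
`x + 1` if they are colored with `x`, and `0` if they are uncolored. -/
def available (col : Option ℕ) (L N : Finset ℕ) (r : ℕ → ℕ) : Finset ℕ :=
  col.elim (L.filter fun x => ∀ i ∈ N, r i ≠ x + 1) fun x => {x}

/-- The neighbours of a node that compete with it for colors. -/
def rivals (col : Option ℕ) (N : Finset ℕ) (r : ℕ → ℕ) : Finset ℕ :=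
  col.elim (N.filter fun i => r i = 0) fun _ => ∅

/-- Color a constant fraction, depending on `D`, of the uncolored nodes. -/
noncomputable def colorSome (F : HashFamily) (p ℓ D c : ℕ) (L N : Finset ℕ) (col : Option ℕ) :
    Prog (Option ℕ) :=
  (exchange (col.elim 0 (· + 1))).bind fun r =>
  (splitDigits F p ℓ c (rivals col N r, available col L N r)).bind fun S =>
  (join F D c S.1).bind fun j =>
  ret (col.elim (if j = 0 then none else some (S.2.sup id)) some)

/-- The number of rounds used by `colorSome`. -/
def colorSomeRounds (q p ℓ : ℕ) : ℕ := q * q + 1 + ℓ * (q * q + p + 3) + 1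

/-- A colored neighbor removes at most one available color, so lists stay longer than the number of
rivals and the initial ratio is at most the number of uncolored nodes. Colored nodes run along with
no rivals and one available color, contributing nothing. New colors avoid old ones by availability
and each other by independence in `K`. -/
theorem runs_colorSome (hid : Function.Injective ident) {F : HashFamily} {m d k p ℓ D C : ℕ}
    (hF : F.Good m d k) (hkp : 2 * p * d ≤ k) (hkD : d * D ≤ k) (hp : p ≠ 0)
    (hD : 2 * 3 ^ ℓ ≤ D) {c : V → ℕ} (hcm : ∀ v, c v < m)
    (hcG : ∀ v u, G.Adj v u → c u ≠ c v) {L : V → Finset ℕ}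
    (hL : ∀ v, ∀ x ∈ L v, x < C) (hdeg : ∀ v, G.degree v + 1 ≤ (L v).card) (hC : C ≤ p ^ ℓ)
    (hmM : m ≤ M) (hFM : F.size * F.size ≤ M) (hpM : p < M) (hCM : C + 1 < M)
    {col : V → Option ℕ} (hcol : IsPartialColoring G L col) :
    Runs G ident M (colorSomeRounds F.size p ℓ)
      (fun v => colorSome F p ℓ D (c v) (L v) ((G.neighborFinset v).image ident) (col v))
      fun col' => IsPartialColoring G L col' ∧
        2 * (D + 1) * (Finset.univ.filter fun v => col' v = none).card
          ≤ (2 * D + 1) * (Finset.univ.filter fun v => col v = none).card := by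
  have hrounds : 0 + (F.size * F.size + 1) + ℓ * (F.size * F.size + p + 3) + 1
      = colorSomeRounds F.size p ℓ := by rw [colorSomeRounds]; ring
  refine Runs.cast (Runs.exchange_bind (fun v => ?_) ?_) hrounds
  · rcases h : col v with _ | x
    · exact (Nat.zero_le _).trans_lt hpM
    · have := hL v x (hcol.mem h)
      change x + 1 < M
      omega
  set U := Finset.univ.filter fun v => col v = none with hU
  set H : V → Finset V := fun v =>
    if col v = none then (G.neighborFinset v).filter fun u => col u = none else ∅ with hHdef
  have hmemH : ∀ {v u}, u ∈ H v ↔ G.Adj v u ∧ col v = none ∧ col u = none := by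
    intro v u
    simp only [hHdef]
    split_ifs with h <;> simp [h]
  have hH : IsSubnetwork G H := ⟨fun h => (hmemH.1 h).1, fun h =>
    have h := hmemH.1 h; hmemH.2 ⟨h.1.symm, h.2.2, h.2.1⟩⟩
  set r := inbox G ident fun v => (col v).elim 0 (· + 1) with hr
  have hrapp : ∀ {v u}, G.Adj v u → r v (ident u) = (col u).elim 0 (· + 1) :=
    fun h => inbox_apply hid _ h
  set A : V → Finset ℕ := fun v =>
    available (col v) (L v) ((G.neighborFinset v).image ident) (r v) with hA
  have hrivals : ∀ v, rivals (col v) ((G.neighborFinset v).image ident) (r v)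
      = (H v).image ident := by
    intro v
    simp only [hHdef]
    rcases h : col v with _ | x
    · rw [if_pos rfl]
      refine filter_image_ident _ _ fun u hu => ?_
      rw [hrapp ((G.mem_neighborFinset v u).1 hu)]
      rcases col u <;> simp
    · rw [if_neg (Option.some_ne_none x)]
      rfl
  have hAnone : ∀ {v x}, col v = none →
      (x ∈ A v ↔ x ∈ L v ∧ ∀ u, G.Adj v u → col u ≠ some x) := by
    intro v x h
    simp only [hA, available, h, Option.elim_none, Finset.mem_filter, Finset.forall_mem_image,
      SimpleGraph.mem_neighborFinset]
    refine and_congr_right fun _ => forall₂_congr fun u hu => ?_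
    rw [hrapp hu]
    rcases col u <;> simp
  have hAsome : ∀ {v x}, col v = some x → A v = {x} := fun h => by simp [hA, available, h]
  have hAL : ∀ v, A v ⊆ L v := by
    intro v x hx
    rcases h : col v with _ | y
    · exact ((hAnone h).1 hx).1
    · rw [hAsome h, Finset.mem_singleton] at hx
      exact hx ▸ hcol.mem h
  have hcardA : ∀ v, (H v).card + 1 ≤ (A v).card := by
    intro v
    rcases h : col v with _ | y
    · have h1 : L v ⊆ A v ∪ ((G.neighborFinset v).filter fun u => col u ≠ none).image
          fun u => (col u).getD 0 := by
        intro x hx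
        rw [Finset.mem_union]
        by_cases hxA : x ∈ A v
        · exact Or.inl hxA
        · right
          rw [hAnone h] at hxA
          push Not at hxA
          obtain ⟨u, hu, hux⟩ := hxA hx
          exact Finset.mem_image.2 ⟨u, by simp [hu, hux], by simp [hux]⟩
      have h2 := (Finset.card_le_card h1).trans (Finset.card_union_le _ _)
      have h3 := Finset.card_image_le (s := (G.neighborFinset v).filter fun u => col u ≠ none)
        (f := fun u => (col u).getD 0)
      have h4 : (H v).card + ((G.neighborFinset v).filter fun u => col u ≠ none).card
          = G.degree v := by
        rw [← G.card_neighborFinset_eq_degree v]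
        simp only [hHdef, if_pos h]
        exact Finset.card_filter_add_card_filter_not _
      have h5 := hdeg v
      omega
    · have : H v = ∅ := by simp only [hHdef, h, if_neg (Option.some_ne_none y)]
      rw [hAsome h, this]
      simp
  have hratio : conflictRatio H A ≤ U.card := by
    have h1 : ∀ v, ((H v).card : ℚ) / (A v).card ≤ if col v = none then 1 else 0 := by
      intro v
      split_ifs with h
      · refine div_le_one_of_le₀ ?_ (Nat.cast_nonneg _)
        exact_mod_cast (Nat.le_succ _).trans (hcardA v)
      · have : H v = ∅ := by simp only [hHdef, if_neg h]
        simp [this]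
    refine (Finset.sum_le_sum fun v _ => h1 v).trans (le_of_eq ?_)
    simp [hU]
  have hAC : ∀ v, (A v).card < M := fun v => by
    have h1 : A v ⊆ Finset.range C := fun x hx => Finset.mem_range.2 (hL v x (hAL v hx))
    have h2 := Finset.card_le_card h1
    rw [Finset.card_range] at h2
    omega
  simp only [hrivals]
  refine Runs.bind (runs_splitDigits hid hF hkp hp hcm hcG hH
    (fun v => Finset.card_pos.1 (Nat.succ_pos _ |>.trans_le (hcardA v)))
    (fun v x hx => (hL v x (hAL v hx)).trans_le hC) hmM hFM hpM hAC) fun S hS => ?_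
  obtain ⟨K, hK, hKH, hS1, hSone, hSconf, hSsum⟩ := hS
  choose x hxA hSx using hSone
  simp only [hS1, hSx, Finset.sup_singleton, id]
  refine Runs.bind (runs_join hid hF hkD hcm hcG hK hmM (by omega)) fun j hj => Runs.ret ?_
  obtain ⟨hjD, hjind, hjmax⟩ := hj
  have hnew : ∀ {v y}, (col v).elim (if j v = 0 then none else some (x v)) some = some y →
      col v = some y ∨ col v = none ∧ j v ≠ 0 ∧ y = x v := by
    intro v y h
    rcases hv : col v with _ | z
    · rw [hv, Option.elim_none] at h
      split_ifs at h with hj0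
      exact Or.inr ⟨rfl, hj0, (Option.some.inj h).symm⟩
    · rw [hv] at h
      exact Or.inl h
  refine ⟨⟨fun {v y} h => ?_, fun {v u y} hvu hv hu => ?_⟩, ?_⟩
  · rcases hnew h with h | ⟨_, _, rfl⟩
    exacts [hcol.mem h, hAL v (hxA v)]
  · rcases hnew hv with hv' | ⟨hv', hjv, hxv⟩ <;> rcases hnew hu with hu' | ⟨hu', hju, hxu⟩
    · exact hcol.proper hvu hv' hu'
    · exact ((hAnone hu').1 (hxA u)).2 v hvu.symm (hxu ▸ hv')
    · exact ((hAnone hv').1 (hxA v)).2 u hvu (hxv ▸ hu')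
    · refine hju (hjind v u (hSconf v u (hmemH.2 ⟨hvu, hv', hu'⟩) ?_) hjv)
      rw [hSx, hSx, ← hxu, ← hxv]
  · have hsum : ∑ v, (K v).card ≤ 3 ^ ℓ * U.card := by
      have := hSsum.trans (mul_le_mul_of_nonneg_left hratio (by positivity))
      exact_mod_cast this
    have hcount := card_le_of_maximal_independent hK (U := U)
      (fun v u hu => Finset.mem_filter.2 ⟨Finset.mem_univ _, (hmemH.1 (hKH v hu)).2.2⟩)
      (by positivity) hD hsum hjD hjmax
    have hleft : (Finset.univ.filter fun v =>
        (col v).elim (if j v = 0 then none else some (x v)) some = none)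
        = U.filter fun v => ¬ j v ≠ 0 := by
      ext v
      rcases hv : col v with _ | z <;> simp [hU, hv]
    rw [hleft]
    have hsplit := Finset.card_filter_add_card_filter_not (s := U) fun v => j v ≠ 0
    nlinarith

/-- Color the nodes from the lists `L`, given identifiers with `b + e` bits. -/
noncomputable def colorAll (b e : ℕ) (F : HashFamily) (p ℓ D R id : ℕ) (L N : Finset ℕ) :
    Prog ℕ :=
  (reduceColors b e id N).bind fun c =>
  (iter R (fun _ => colorSome F p ℓ D c L N) none).bind fun col =>
  ret (col.getD 0)

/-- Bernoulli: `(1 + 1 / E) ^ (E + 1) ≥ 1 + (E + 1) / E ≥ 2`. -/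
theorem two_mul_pow_le (E : ℕ) : 2 * E ^ (E + 1) ≤ (E + 1) ^ (E + 1) := by
  rcases Nat.eq_zero_or_pos E with rfl | hE
  · simp
  · have h : (E : ℚ) ^ (E + 1) * 2 ≤ (E + 1) ^ (E + 1) := by
      have hE' : (0 : ℚ) < E := by exact_mod_cast hE
      have h1 := one_add_mul_le_pow (a := (1 : ℚ) / E)
        (by have : (0 : ℚ) ≤ 1 / E := by positivity
            linarith) (E + 1)
      have h2 : (2 : ℚ) ≤ 1 + ((E + 1 : ℕ) : ℚ) * (1 / E) := by
        push_cast
        have : ((E : ℚ) + 1) * (1 / E) = 1 + 1 / E := by field_simp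
        have : (0 : ℚ) ≤ 1 / E := by positivity
        linarith
      calc (E : ℚ) ^ (E + 1) * 2 ≤ (E : ℚ) ^ (E + 1) * (1 + 1 / E) ^ (E + 1) :=
            mul_le_mul_of_nonneg_left (h2.trans h1) (by positivity)
        _ = _ := by rw [← mul_pow]; congr 1; field_simp
    have h' : E ^ (E + 1) * 2 ≤ (E + 1) ^ (E + 1) := by exact_mod_cast h
    linarith

/-- With `E = 2 * D + 1`, a phase shrinks the uncolored set by the factor `E / (E + 1)`, so `E + 1`
phases halve the bound. After `T` such blocks it is below one. -/
theorem runs_colorAll (hid : Function.Injective ident) {F : HashFamily}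
    {b e d k p ℓ D C T : ℕ} (hb : 13 ≤ b) (hΔ : 2 * G.maxDegree ≤ 2 ^ (b / 3))
    (hident : ∀ v, ident v < 2 ^ (b + e))
    (hF : F.Good (2 ^ b) d k) (hkp : 2 * p * d ≤ k) (hkD : d * D ≤ k) (hp : p ≠ 0)
    (hD : 2 * 3 ^ ℓ ≤ D) {L : V → Finset ℕ}
    (hL : ∀ v, ∀ x ∈ L v, x < C) (hdeg : ∀ v, G.degree v + 1 ≤ (L v).card) (hC : C ≤ p ^ ℓ)
    (hT : Fintype.card V < 2 ^ T) (hbM : 2 ^ (b + e) ≤ M) (hFM : F.size * F.size ≤ M)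
    (hpM : p < M) (hCM : C + 1 < M) :
    Runs G ident M ((2 * D + 1 + 1) * T * colorSomeRounds F.size p ℓ + e)
      (fun v => colorAll b e F p ℓ D ((2 * D + 1 + 1) * T) (ident v) (L v)
        ((G.neighborFinset v).image ident))
      fun x => (∀ v, x v ∈ L v) ∧ ∀ v u, G.Adj v u → x v ≠ x u := by
  have hrounds : 0 + (2 * D + 1 + 1) * T * colorSomeRounds F.size p ℓ + e * 1
      = (2 * D + 1 + 1) * T * colorSomeRounds F.size p ℓ + e := by ring
  refine Runs.cast (Runs.bind (runs_reduceColors hid hb hΔ hbM hident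
    fun v u h heq => h.ne (hid heq).symm) fun c hc => Runs.bind (Runs.iter
    (fun n col => IsPartialColoring G L col ∧
      (2 * D + 1 + 1) ^ n * (Finset.univ.filter fun v => col v = none).card
        ≤ (2 * D + 1) ^ n * Fintype.card V) _ (fun n hn col hcol => ?_) ?_)
    fun col hcol => Runs.ret ?_) hrounds
  · refine (runs_colorSome hid hF hkp hkD hp hD hc.1 hc.2 hL hdeg hC
      ((Nat.pow_le_pow_right two_pos (Nat.le_add_right _ _)).trans hbM) hFM hpM hCM
      hcol.1).mono fun col' h => ⟨h.1, ?_⟩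
    calc _ = (2 * D + 1 + 1) ^ n * (2 * (D + 1) *
          (Finset.univ.filter fun v => col' v = none).card) := by ring
      _ ≤ (2 * D + 1 + 1) ^ n * ((2 * D + 1) *
          (Finset.univ.filter fun v => col v = none).card) := Nat.mul_le_mul_left _ h.2
      _ = (2 * D + 1) * ((2 * D + 1 + 1) ^ n *
          (Finset.univ.filter fun v => col v = none).card) := by ring
      _ ≤ (2 * D + 1) * ((2 * D + 1) ^ n * Fintype.card V) := Nat.mul_le_mul_left _ hcol.2
      _ = _ := by ring
  · refine ⟨⟨fun h => by simp at h, fun _ h => by simp at h⟩, ?_⟩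
    simp
  · have hzero : (Finset.univ.filter fun v => col v = none).card = 0 := by
      by_contra hne
      have h1 : 2 ^ T * (2 * D + 1) ^ ((2 * D + 1 + 1) * T)
          ≤ (2 * D + 1 + 1) ^ ((2 * D + 1 + 1) * T) := by
        rw [pow_mul, pow_mul, ← mul_pow]
        exact Nat.pow_le_pow_left (two_mul_pow_le _) _
      have h2 := Nat.le_mul_of_pos_right ((2 * D + 1 + 1) ^ ((2 * D + 1 + 1) * T))
        (Nat.pos_of_ne_zero hne)
      have h3 := (h1.trans h2).trans hcol.2
      rw [Nat.mul_comm] at h3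
      exact absurd (Nat.le_of_mul_le_mul_left h3 (by positivity)) (by omega)
    have hsome : ∀ v, col v = some ((col v).getD 0) := by
      intro v
      rcases h : col v with _ | x
      · rw [Finset.card_eq_zero] at hzero
        exact absurd (Finset.mem_filter.2 ⟨Finset.mem_univ v, h⟩) (hzero ▸ Finset.notMem_empty v)
      · rfl
    refine ⟨fun v => hcol.1.mem (hsome v), fun v u hvu heq => ?_⟩
    exact hcol.1.proper hvu (hsome v) ((hsome u).trans (congrArg some heq.symm))

end Prog

end

/-! ### Parameters and asymptotic bounds. -/

theorem Polynomial.eval_le_eval_one_mul_pow (P : Polynomial ℕ) {x : ℕ} (hx : 1 ≤ x) :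
    P.eval x ≤ P.eval 1 * x ^ P.natDegree := by
  rw [Polynomial.eval_eq_sum_range, Polynomial.eval_eq_sum_range, Finset.sum_mul]
  refine Finset.sum_le_sum fun i hi => ?_
  rw [one_pow, Nat.mul_one]
  exact Nat.mul_le_mul_left _ (Nat.pow_le_pow_right hx (Nat.lt_succ_iff.1 (Finset.mem_range.1 hi)))

/-- The number of color bits per bit of the maximum degree, for colors below `P.eval Δ`. -/
def colorExponent (P : Polynomial ℕ) : ℕ := P.natDegree + (P.eval 1).size + 1

theorem eval_le_two_pow (P : Polynomial ℕ) {Δ w : ℕ} (hΔ : 1 ≤ Δ) (hw : 1 ≤ w) (h : Δ < 2 ^ w) :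
    P.eval Δ ≤ 2 ^ (colorExponent P * w) := by
  calc P.eval Δ ≤ P.eval 1 * Δ ^ P.natDegree := P.eval_le_eval_one_mul_pow hΔ
    _ ≤ 2 ^ (P.eval 1).size * (2 ^ w) ^ P.natDegree :=
      Nat.mul_le_mul (Nat.lt_size_self _).le (Nat.pow_le_pow_left h.le _)
    _ = 2 ^ ((P.eval 1).size + w * P.natDegree) := by rw [← pow_mul, ← pow_add]
    _ ≤ _ := Nat.pow_le_pow_right two_pos (by rw [colorExponent]; nlinarith)

/-- The parameters of the coloring algorithm, where `2 ^ w` bounds the maximum degree and `s ^ 2`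
bounds `w`. -/
structure Params where
  w : ℕ
  s : ℕ
  p : ℕ
  D : ℕ
  k : ℕ

/-- The parameters for maximum degree `Δ` and colors of at most `c * w` bits. -/
def params (c Δ : ℕ) : Params :=
  let w := Nat.log 2 Δ + 1
  let s := Nat.sqrt w + 1
  let p := 2 ^ (c * s)
  let D := 2 * 3 ^ s
  -- With polynomials of degree `d = 13 * w`, this `k` satisfies both `2 * p * d ≤ k` for splitting
  -- and `d * D ≤ k` for joining.
  { w, s, p, D, k := 13 * w * (2 * p) * D }

namespace Params

/-- The hash family used to compute colorings with few monochromatic edges. -/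
noncomputable def family (q : Params) : HashFamily := goodHash (2 ^ (13 * q.w)) (13 * q.w) q.k

variable {c Δ : ℕ}

theorem w_pos : 1 ≤ (params c Δ).w := Nat.le_add_left _ _

theorem s_pos : 1 ≤ (params c Δ).s := Nat.le_add_left _ _

theorem lt_two_pow_w : Δ < 2 ^ (params c Δ).w := Nat.lt_pow_succ_log_self one_lt_two Δ

theorem w_le : (params c Δ).w ≤ (params c Δ).s * (params c Δ).s :=
  (Nat.lt_succ_sqrt _).le

theorem s_le : (params c Δ).s ≤ 2 * (params c Δ).w := by
  have h1 : Nat.sqrt (params c Δ).w ≤ (params c Δ).w := Nat.sqrt_le_self _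
  have h2 : (params c Δ).s = Nat.sqrt (params c Δ).w + 1 := rfl
  have h3 := w_pos (c := c) (Δ := Δ)
  omega

/-- The balance behind the square root: `s` digits of `c * s` bits cover `c * w` bits because `w ≤ s
^ 2`. -/
theorem two_pow_w_le : 2 ^ (c * (params c Δ).w) ≤ (params c Δ).p ^ (params c Δ).s := by
  change _ ≤ (2 ^ (c * (params c Δ).s)) ^ (params c Δ).s
  rw [← pow_mul, Nat.mul_assoc]
  exact Nat.pow_le_pow_right two_pos (Nat.mul_le_mul_left _ w_le)

theorem k_eq : (params c Δ).k =
    13 * (params c Δ).w * (2 * (params c Δ).p) * (params c Δ).D := rfl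

theorem p_pos : 0 < (params c Δ).p := Nat.two_pow_pos _

theorem D_pos : 0 < (params c Δ).D := by
  change 0 < 2 * 3 ^ _
  positivity

theorem family_good :
    (params c Δ).family.Good (2 ^ (13 * (params c Δ).w)) (13 * (params c Δ).w) (params c Δ).k := by
  have h2 : 2 ≤ (params c Δ).k := by
    rw [k_eq]
    have h1 := w_pos (c := c) (Δ := Δ)
    have h2 := p_pos (c := c) (Δ := Δ)
    have h3 := D_pos (c := c) (Δ := Δ)
    have := Nat.mul_le_mul (Nat.mul_le_mul (by omega : 1 ≤ 13 * (params c Δ).w)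
      (by omega : 2 ≤ 2 * (params c Δ).p)) h3
    omega
  refine goodHash_good (by omega) ?_
  calc 2 ^ (13 * (params c Δ).w) ≤ 2 ^ (13 * (params c Δ).w + 1) :=
        Nat.pow_le_pow_right two_pos (Nat.le_succ _)
    _ ≤ _ := Nat.pow_le_pow_left h2 _

theorem s_le_two_pow : (params c Δ).s ≤ 2 ^ (params c Δ).s := Nat.lt_two_pow_self.le

theorem D_le : (params c Δ).D ≤ 2 ^ (3 * (params c Δ).s) := by
  change 2 * 3 ^ (params c Δ).s ≤ _
  have h1 : 2 * 3 ^ (params c Δ).s ≤ 2 ^ (params c Δ).s * 4 ^ (params c Δ).s :=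
    Nat.mul_le_mul (Nat.le_self_pow (by have := s_pos (c := c) (Δ := Δ); omega) 2)
      (Nat.pow_le_pow_left (by norm_num) _)
  refine h1.trans (le_of_eq ?_)
  rw [show 4 = 2 ^ 2 from rfl, ← pow_mul, ← pow_add]
  congr 1
  ring

theorem size_le : (params c Δ).family.size ≤ 2 ^ ((c + 11) * (params c Δ).s) := by
  have hs := s_pos (c := c) (Δ := Δ)
  have h1 : 13 * (params c Δ).w
      ≤ 2 ^ (4 * (params c Δ).s) * (2 ^ (params c Δ).s * 2 ^ (params c Δ).s) := by
    refine Nat.mul_le_mul ?_ (w_le.trans (Nat.mul_le_mul s_le_two_pow s_le_two_pow))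
    exact le_trans (by norm_num : 13 ≤ 2 ^ 4) (Nat.pow_le_pow_right two_pos (by omega))
  have h2 : 2 ≤ 2 ^ (params c Δ).s := Nat.le_self_pow (by omega) 2
  have h3 : 2 * (params c Δ).p ≤ 2 ^ (params c Δ).s * 2 ^ (c * (params c Δ).s) :=
    Nat.mul_le_mul_right _ h2
  refine family_good.size_le.trans ?_
  rw [k_eq]
  refine (Nat.mul_le_mul h2 (Nat.mul_le_mul (Nat.mul_le_mul h1 h3) D_le)).trans (le_of_eq ?_)
  simp only [← pow_add]
  congr 1
  ring

theorem size_mul_size_le :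
    (params c Δ).family.size * (params c Δ).family.size
      ≤ 2 ^ ((2 * c + 22) * (params c Δ).s) := by
  refine (Nat.mul_le_mul size_le size_le).trans (le_of_eq ?_)
  rw [← pow_add]
  congr 1
  ring

/-- Every factor is `2 ^ O(s)`, including the number of digits `s`; the `a * T` rounds of the
initial color reduction are absorbed. -/
theorem rounds_le (a T : ℕ) :
    (2 * (params c Δ).D + 1 + 1) * T *
        Prog.colorSomeRounds (params c Δ).family.size (params c Δ).p (params c Δ).s + a * T
      ≤ 2 ^ ((2 * c + 32 + a) * (params c Δ).s) * T := by
  obtain ⟨s, hs⟩ : ∃ s, s = (params c Δ).s := ⟨_, rfl⟩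
  have hs1 : 1 ≤ s := hs ▸ s_pos
  have hq := size_mul_size_le (c := c) (Δ := Δ)
  have hD := D_le (c := c) (Δ := Δ)
  have hp : (params c Δ).p = 2 ^ (c * (params c Δ).s) := rfl
  have hD1 := D_pos (c := c) (Δ := Δ)
  rw [Prog.colorSomeRounds, hp]
  rw [← hs] at *
  set q2 := (params c Δ).family.size * (params c Δ).family.size
  set Q := 2 ^ ((2 * c + 22) * s) with hQ
  have hpQ : 2 ^ (c * s) ≤ Q := Nat.pow_le_pow_right two_pos (by nlinarith)
  have h3Q : 3 ≤ Q := le_trans (by norm_num : 3 ≤ 2 ^ 2)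
    (Nat.pow_le_pow_right two_pos (by nlinarith))
  have hsum : q2 + 1 + s * (q2 + 2 ^ (c * s) + 3) + 1 ≤ 6 * s * Q := by
    have h1 : s * (q2 + 2 ^ (c * s) + 3) ≤ s * (3 * Q) := Nat.mul_le_mul_left _ (by omega)
    nlinarith
  have h2s : ∀ i, 2 ^ i ≤ 2 ^ (i * s) := fun i => Nat.pow_le_pow_right two_pos (by nlinarith)
  have h6 : 6 * s * Q ≤ 2 ^ (3 * s) * 2 ^ s * Q :=
    Nat.mul_le_mul_right _ (Nat.mul_le_mul ((by norm_num : 6 ≤ 2 ^ 3).trans (h2s 3))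
      Nat.lt_two_pow_self.le)
  have hD4 : 2 * (params c Δ).D + 1 + 1 ≤ 2 ^ (2 * s) * 2 ^ (3 * s) :=
    le_trans (by omega : _ ≤ 4 * (params c Δ).D)
      (Nat.mul_le_mul ((by norm_num : 4 ≤ 2 ^ 2).trans (h2s 2)) hD)
  have hfirst : (2 * (params c Δ).D + 1 + 1) * (q2 + 1 + s * (q2 + 2 ^ (c * s) + 3) + 1)
      ≤ 2 ^ ((2 * c + 31) * s) := by
    refine (Nat.mul_le_mul hD4 (hsum.trans h6)).trans (le_of_eq ?_)
    rw [hQ]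
    simp only [← pow_add]
    congr 1
    ring
  have ha : a ≤ 2 ^ (a * s) := Nat.lt_two_pow_self.le.trans (h2s a)
  have h1 : 2 ^ ((2 * c + 31) * s) ≤ 2 ^ ((2 * c + 31 + a) * s) :=
    Nat.pow_le_pow_right two_pos (by nlinarith)
  have h2 : 2 ^ (a * s) ≤ 2 ^ ((2 * c + 31 + a) * s) :=
    Nat.pow_le_pow_right two_pos (by nlinarith)
  have h3 : 2 * 2 ^ ((2 * c + 31 + a) * s) ≤ 2 ^ ((2 * c + 32 + a) * s) := by
    rw [← pow_succ']
    exact Nat.pow_le_pow_right two_pos (by nlinarith)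
  calc _ = ((2 * (params c Δ).D + 1 + 1) * (q2 + 1 + s * (q2 + 2 ^ (c * s) + 3) + 1) + a) * T := by
        ring
    _ ≤ _ := Nat.mul_le_mul_right _ (by omega)

/-- As `logb 2 Δ ≥ 1`, the added ones in `w` and `s` are absorbed. This fails for `Δ ≤ 1`, which is
therefore treated separately. -/
theorem s_le_sqrt (hΔ : 2 ≤ Δ) : ((params c Δ).s : ℝ) ≤ 3 * √(Real.logb 2 Δ) := by
  have hlog : (1 : ℝ) ≤ Real.logb 2 Δ := by
    rw [Real.le_logb_iff_rpow_le one_lt_two (by positivity)]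
    simpa using (by exact_mod_cast hΔ : (2 : ℝ) ≤ Δ)
  have hw : ((params c Δ).w : ℝ) ≤ 4 * Real.logb 2 Δ := by
    have h1 : (Nat.log 2 Δ : ℝ) ≤ Real.logb 2 Δ := by exact_mod_cast Real.natLog_le_logb Δ 2
    have h2 : ((params c Δ).w : ℝ) = (Nat.log 2 Δ : ℝ) + 1 := by
      change ((Nat.log 2 Δ + 1 : ℕ) : ℝ) = _
      push_cast
      rfl
    linarith
  have h1 : ((Nat.sqrt (params c Δ).w : ℕ) : ℝ) ≤ 2 * √(Real.logb 2 Δ) := by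
    refine Real.nat_sqrt_le_real_sqrt.trans (Real.sqrt_le_iff.2 ⟨by positivity, ?_⟩)
    rw [mul_pow, Real.sq_sqrt (by linarith)]
    linarith
  have h2 : (1 : ℝ) ≤ √(Real.logb 2 Δ) := Real.one_le_sqrt.2 hlog
  have h3 : ((params c Δ).s : ℝ) = (Nat.sqrt (params c Δ).w : ℕ) + 1 := by
    change ((Nat.sqrt (params c Δ).w + 1 : ℕ) : ℝ) = _
    push_cast
    rfl
  linarith

end Params

theorem one_le_logb_two {n : ℕ} (hn : 2 ≤ n) : (1 : ℝ) ≤ Real.logb 2 n := by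
  rw [Real.le_logb_iff_rpow_le one_lt_two (by positivity)]
  simpa using (by exact_mod_cast hn : (2 : ℝ) ≤ n)

theorem log_succ_le_two_mul_logb {n : ℕ} (hn : 2 ≤ n) :
    ((Nat.log 2 n + 1 : ℕ) : ℝ) ≤ 2 * Real.logb 2 n := by
  have h1 : (Nat.log 2 n : ℝ) ≤ Real.logb 2 n := by exact_mod_cast Real.natLog_le_logb n 2
  have := one_le_logb_two hn
  push_cast
  linarith

theorem two_pow_mul_le_roundBound {n Δ c A : ℕ} (hΔ : 2 ≤ Δ) (hn : 2 ≤ n) :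
    ((2 ^ (A * (params c Δ).s) * (Nat.log 2 n + 1) : ℕ) : ℝ)
      ≤ roundBound (3 * ((A : ℝ) + 1)) n Δ := by
  have hs := Params.s_le_sqrt (c := c) hΔ
  have hs1 : (1 : ℝ) ≤ (params c Δ).s := by exact_mod_cast Params.s_pos (c := c) (Δ := Δ)
  have hlog := one_le_logb_two hn
  have hT := log_succ_le_two_mul_logb hn
  -- The factor `2` stems from `hT` and fits into the exponent because `1 ≤ s`.
  have hpow : (2 : ℝ) ^ (A * (params c Δ).s) * 2
      ≤ (2 : ℝ) ^ (3 * ((A : ℝ) + 1) * √(Real.logb 2 Δ)) := by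
    rw [← pow_succ, ← Real.rpow_natCast]
    refine Real.rpow_le_rpow_of_exponent_le one_le_two ?_
    push_cast
    have := mul_le_mul_of_nonneg_left hs (by positivity : (0 : ℝ) ≤ (A : ℝ) + 1)
    linarith
  rw [roundBound]
  calc _ = (2 : ℝ) ^ (A * (params c Δ).s) * ((Nat.log 2 n + 1 : ℕ) : ℝ) := by push_cast; ring
    _ ≤ (2 : ℝ) ^ (A * (params c Δ).s) * (2 * Real.logb 2 n) :=
      mul_le_mul_of_nonneg_left hT (by positivity)
    _ = (2 : ℝ) ^ (A * (params c Δ).s) * 2 * Real.logb 2 n := by ring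
    _ ≤ _ := mul_le_mul_of_nonneg_right hpow (by linarith)

/-! ### The list coloring program and its complexity. -/

namespace Prog

/-- The list coloring program, for colors below `P.eval Δ` and identifiers below `n ^ a`. -/
noncomputable def listColoring (P : Polynomial ℕ) (a : ℕ) (x : NodeView (Finset ℕ)) : Prog ℕ :=
  if x.maxDeg = 0 then ret (argminOn x.input id)
  else if x.maxDeg = 1 then (exchange (argminOn x.input id)).bind fun r =>
    ret (argminOn (x.input.filter fun y => ∀ i ∈ x.nbrIdents, i < x.ident → y ≠ r i) id)
  else
    let q := params (colorExponent P) x.maxDeg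
    let T := Nat.log 2 x.nodeCount + 1
    colorAll (13 * q.w) (a * T) q.family q.p q.s q.D ((2 * q.D + 1 + 1) * T) x.ident x.input
      x.nbrIdents

variable {V : Type*} [Fintype V] {G : SimpleGraph V} [DecidableRel G.Adj] {ident : V → ℕ}
  {L : V → Finset ℕ}

theorem runs_listColoring_of_maxDegree_eq_zero (P : Polynomial ℕ) (a : ℕ)
    (hdeg : ∀ v, G.degree v + 1 ≤ (L v).card) (h : G.maxDegree = 0) :
    Runs G ident 0 0 (fun v => listColoring P a (G.view ident L v))
      fun x => (∀ v, x v ∈ L v) ∧ ∀ v u, G.Adj v u → x v ≠ x u := by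
  simp only [listColoring, h, if_true]
  refine Runs.ret ⟨fun v => argminOn_mem (Finset.card_pos.1 (by have := hdeg v; omega)) _,
    fun v u hvu => ?_⟩
  have h1 := (G.degree_pos_iff_exists_adj v).2 ⟨u, hvu⟩
  have h2 := G.degree_le_maxDegree v
  omega

/-- The edges form a matching. The endpoint with the smaller identifier keeps its least color, and
the other one, having two colors, avoids it. -/
theorem runs_listColoring_of_maxDegree_eq_one (hid : Function.Injective ident)
    (P : Polynomial ℕ) (a : ℕ) (hL : ∀ v, ∀ x ∈ L v, x < P.eval 1)
    (hdeg : ∀ v, G.degree v + 1 ≤ (L v).card) (h : G.maxDegree = 1) :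
    Runs G ident (P.eval 1) 1 (fun v => listColoring P a (G.view ident L v))
      fun x => (∀ v, x v ∈ L v) ∧ ∀ v u, G.Adj v u → x v ≠ x u := by
  simp only [listColoring, h, one_ne_zero, if_true, if_false]
  have hmin : ∀ v, argminOn (L v) id ∈ L v := fun v =>
    argminOn_mem (Finset.card_pos.1 (by have := hdeg v; omega)) _
  have huniq : ∀ {v u u'}, G.Adj v u → G.Adj v u' → u = u' := by
    intro v u u' hu hu'
    have h1 := G.degree_le_maxDegree v
    rw [h, ← G.card_neighborFinset_eq_degree, Finset.card_le_one] at h1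
    exact h1 u (by simpa using hu) u' (by simpa using hu')
  refine Runs.exchange_bind (fun v => hL v _ (hmin v)) (Runs.ret ?_)
  set r := inbox G ident fun v => argminOn (L v) id with hr
  have hrapp : ∀ {v u}, G.Adj v u → r v (ident u) = argminOn (L u) id :=
    fun h => inbox_apply hid _ h
  simp only [Finset.forall_mem_image, SimpleGraph.mem_neighborFinset]
  have hmem : ∀ v, argminOn ((L v).filter fun y => ∀ ⦃u⦄, G.Adj v u → ident u < ident v →
      y ≠ r v (ident u)) id ∈ (L v).filter fun y => ∀ ⦃u⦄, G.Adj v u → ident u < ident v →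
      y ≠ r v (ident u) := by
    intro v
    refine argminOn_mem ?_ _
    by_cases hv : ∃ u, G.Adj v u
    · obtain ⟨u, hu⟩ := hv
      have h1 := (G.degree_pos_iff_exists_adj v).2 ⟨u, hu⟩
      obtain ⟨y, hy, hne⟩ := Finset.exists_mem_ne (by have := hdeg v; omega : 1 < (L v).card)
        (r v (ident u))
      exact ⟨y, Finset.mem_filter.2 ⟨hy, fun u' hu' _ => huniq hu hu' ▸ hne⟩⟩
    · exact ⟨_, Finset.mem_filter.2 ⟨hmin v, fun u hu => absurd ⟨u, hu⟩ hv⟩⟩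
  refine ⟨fun v => (Finset.mem_filter.1 (hmem v)).1, ?_⟩
  have key : ∀ v u, G.Adj v u → ident u < ident v →
      argminOn ((L v).filter fun y => ∀ ⦃u⦄, G.Adj v u → ident u < ident v →
        y ≠ r v (ident u)) id
      ≠ argminOn ((L u).filter fun y => ∀ ⦃w⦄, G.Adj u w → ident w < ident u →
        y ≠ r u (ident w)) id := by
    intro v u hvu hlt
    have h1 : ((L u).filter fun y => ∀ ⦃w⦄, G.Adj u w → ident w < ident u →
        y ≠ r u (ident w)) = L u := by
      refine Finset.filter_true_of_mem fun y _ w hw hwu => ?_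
      rw [← huniq hvu.symm hw] at hwu
      omega
    have h2 := (Finset.mem_filter.1 (hmem v)).2 hvu hlt
    rw [hrapp hvu] at h2
    rwa [h1]
  intro v u hvu
  rcases lt_or_gt_of_ne (fun heq => hvu.ne (hid heq) : ident v ≠ ident u) with hlt | hlt
  · exact (key u v hvu.symm hlt).symm
  · exact key v u hvu hlt

theorem runs_listColoring_of_two_le_maxDegree (P : Polynomial ℕ) (a : ℕ)
    (hident : ValidIdents a ident) (hL : ∀ v, ∀ x ∈ L v, x < P.eval G.maxDegree)
    (hdeg : ∀ v, G.degree v + 1 ≤ (L v).card) (h : 2 ≤ G.maxDegree) :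
    ∃ t M, Runs G ident M t (fun v => listColoring P a (G.view ident L v))
      (fun x => (∀ v, x v ∈ L v) ∧ ∀ v u, G.Adj v u → x v ≠ x u) ∧
      t ≤ 2 ^ ((2 * colorExponent P + 32 + a) * (params (colorExponent P) G.maxDegree).s) *
        (Nat.log 2 (Fintype.card V) + 1) ∧
      M.size ≤ (60 + a + 5 * colorExponent P) * (Nat.log 2 (Fintype.card V) + 1) := by
  set c := colorExponent P with hc
  set q := params c G.maxDegree with hq
  set T := Nat.log 2 (Fintype.card V) + 1 with hT
  have hw : 1 ≤ q.w := Params.w_pos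
  have hΔw : G.maxDegree < 2 ^ q.w := Params.lt_two_pow_w
  have hF : q.family.Good (2 ^ (13 * q.w)) (13 * q.w) q.k := Params.family_good
  have hk : q.k = 13 * q.w * (2 * q.p) * q.D := Params.k_eq
  have hp : 0 < q.p := Params.p_pos
  have hD : 0 < q.D := Params.D_pos
  have hn : Fintype.card V < 2 ^ T := Nat.lt_pow_succ_log_self one_lt_two _
  have hC : P.eval G.maxDegree ≤ 2 ^ (c * q.w) := eval_le_two_pow P (by omega) hw hΔw
  have hq2 : q.family.size * q.family.size ≤ 2 ^ ((2 * c + 22) * q.s) := Params.size_mul_size_le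
  have hpval : q.p = 2 ^ (c * q.s) := rfl
  have hwT : q.w ≤ T := by
    have : Nonempty V := by
      by_contra hV
      rw [not_nonempty_iff] at hV
      simp at h
    have h1 : G.maxDegree ≤ Fintype.card V := (G.maxDegree_lt_card_verts).le
    exact Nat.succ_le_succ (Nat.log_mono_right h1)
  have hs : q.s ≤ 2 * q.w := Params.s_le
  -- The sum of the bit lengths of all kinds of messages; it is linear in `T` because `Δ < n` gives
  -- `q.w ≤ T`.
  set W := 13 * q.w + a * T + (2 * c + 22) * q.s + c * q.w + 2 with hW
  have hpow : ∀ {i}, i ≤ W → 2 ^ i ≤ 2 ^ W := fun h => Nat.pow_le_pow_right two_pos h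
  have hpow' : ∀ {i}, i < W → 2 ^ i < 2 ^ W := fun h => Nat.pow_lt_pow_right one_lt_two h
  refine ⟨_, 2 ^ W, ?_, Params.rounds_le (c := c) (Δ := G.maxDegree) a T, ?_⟩
  · have h0 : G.maxDegree ≠ 0 := by omega
    have h1 : G.maxDegree ≠ 1 := by omega
    simp only [listColoring, if_neg h0, if_neg h1]
    suffices Runs G ident (2 ^ W)
        ((2 * q.D + 1 + 1) * T * colorSomeRounds q.family.size q.p q.s + a * T)
        (fun v => colorAll (13 * q.w) (a * T) q.family q.p q.s q.D ((2 * q.D + 1 + 1) * T) (ident v)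
          (L v) ((G.neighborFinset v).image ident))
        fun x => (∀ v, x v ∈ L v) ∧ ∀ v u, G.Adj v u → x v ≠ x u from this
    refine runs_colorAll hident.1 (b := 13 * q.w) (d := 13 * q.w) (k := q.k)
      (C := P.eval G.maxDegree) (by omega) ?_ (fun v => ?_) hF ?_ ?_ hp.ne' le_rfl hL hdeg
      (hC.trans Params.two_pow_w_le) hn (hpow (by omega))
      (hq2.trans (hpow (by omega))) ?_ ?_
    · calc 2 * G.maxDegree ≤ 2 * 2 ^ q.w := Nat.mul_le_mul_left _ hΔw.le
        _ = 2 ^ (q.w + 1) := (pow_succ' _ _).symm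
        _ ≤ _ := Nat.pow_le_pow_right two_pos (by omega)
    · calc ident v < Fintype.card V ^ a := hident.2 v
        _ ≤ (2 ^ T) ^ a := Nat.pow_le_pow_left hn.le _
        _ = 2 ^ (a * T) := by rw [← pow_mul, Nat.mul_comm]
        _ ≤ _ := Nat.pow_le_pow_right two_pos (by omega)
    · rw [hk]
      calc 2 * q.p * (13 * q.w) = 13 * q.w * (2 * q.p) * 1 := by ring
        _ ≤ _ := Nat.mul_le_mul_left _ hD
    · rw [hk]
      calc 13 * q.w * q.D = 13 * q.w * 1 * q.D := by ring
        _ ≤ _ := Nat.mul_le_mul_right _ (Nat.mul_le_mul_left _ (by omega))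
    · rw [hpval]
      refine hpow' ?_
      have : c * q.s ≤ (2 * c + 22) * q.s := Nat.mul_le_mul_right _ (by omega)
      omega
    · have h1 : 2 ^ (c * q.w + 1) < 2 ^ W := hpow' (by omega)
      have h2 : 1 ≤ 2 ^ (c * q.w) := Nat.one_le_two_pow
      rw [pow_succ] at h1
      omega
  · rw [Nat.size_pow]
    have h1 : (2 * c + 22) * q.s ≤ (2 * c + 22) * (2 * T) := Nat.mul_le_mul_left _ (by omega)
    have h2 : c * q.w ≤ c * T := Nat.mul_le_mul_left _ hwT
    nlinarith

/-- The constant in the exponent of the round bound of `listColoring`. -/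
noncomputable def roundConstant (P : Polynomial ℕ) (a : ℕ) : ℝ :=
  3 * (((2 * colorExponent P + 32 + a : ℕ) : ℝ) + 1)

/-- The constant in the bound on the message size of `listColoring`. -/
noncomputable def messageConstant (P : Polynomial ℕ) (a : ℕ) : ℝ :=
  2 * (60 + a + 5 * colorExponent P : ℕ) + (P.eval 1).size

/-- Round and message complexity of `listColoring`. -/
theorem exists_runs_listColoring (P : Polynomial ℕ) (a : ℕ)
    (hident : ValidIdents a ident) (hL : ∀ v, ∀ x ∈ L v, x < P.eval G.maxDegree)
    (hdeg : ∀ v, G.degree v + 1 ≤ (L v).card) :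
    ∃ t M, Runs G ident M t (fun v => listColoring P a (G.view ident L v))
      (fun x => (∀ v, x v ∈ L v) ∧ ∀ v u, G.Adj v u → x v ≠ x u) ∧
      (t : ℝ) ≤ roundBound (roundConstant P a) (Fintype.card V) G.maxDegree ∧
      ∀ v u, G.Adj v u → (M.size : ℝ) ≤ messageConstant P a * Real.logb 2 (Fintype.card V) := by
  have hconst : (0 : ℝ) ≤ messageConstant P a := by
    rw [messageConstant]
    positivity
  have hcard : 1 ≤ G.maxDegree → 2 ≤ Fintype.card V := by
    intro h
    have : Nonempty V := by
      by_contra hV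
      rw [not_nonempty_iff] at hV
      simp at h
    have := G.maxDegree_lt_card_verts
    omega
  rcases Nat.lt_or_ge G.maxDegree 2 with h | h
  · interval_cases hΔ : G.maxDegree
    · refine ⟨0, 0, runs_listColoring_of_maxDegree_eq_zero P a hdeg hΔ, ?_, fun v u _ => ?_⟩
      · rw [roundBound, Nat.cast_zero]
        exact mul_nonneg (by positivity) (div_nonneg (Real.log_natCast_nonneg _)
          (Real.log_nonneg one_le_two))
      · rw [Nat.size_zero, Nat.cast_zero]
        exact mul_nonneg hconst (div_nonneg (Real.log_natCast_nonneg _)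
          (Real.log_nonneg one_le_two))
    · have hlog := one_le_logb_two (hcard le_rfl)
      refine ⟨1, _, runs_listColoring_of_maxDegree_eq_one hident.1 P a hL hdeg hΔ, ?_,
        fun v u _ => ?_⟩
      -- `logb 2 1 = 0`, so the first factor is `1` and the single round is paid for by `logb 2 n ≥
      -- 1`.
      · simpa [roundBound] using hlog
      · have h1 : ((P.eval 1).size : ℝ)
            ≤ messageConstant P a := by
          rw [messageConstant]
          have : (0 : ℝ) ≤ (60 + a + 5 * colorExponent P : ℕ) := Nat.cast_nonneg _
          linarith
        have h2 : (0 : ℝ) ≤ (P.eval 1).size := Nat.cast_nonneg _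
        nlinarith
  · obtain ⟨t, M, hruns, ht, hM⟩ := runs_listColoring_of_two_le_maxDegree P a hident hL hdeg h
    have hn := hcard (by omega)
    refine ⟨t, M, hruns, (Nat.cast_le.2 ht).trans (two_pow_mul_le_roundBound h hn),
      fun v u _ => (Nat.cast_le.2 hM).trans ?_⟩
    have h1 := log_succ_le_two_mul_logb hn
    have h2 := one_le_logb_two hn
    have h3 : (0 : ℝ) ≤ (P.eval 1).size := Nat.cast_nonneg _
    have h4 := mul_le_mul_of_nonneg_left h1
      (Nat.cast_nonneg (60 + a + 5 * colorExponent P) : (0 : ℝ) ≤ _)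
    rw [Nat.cast_mul, messageConstant]
    nlinarith

end Prog

theorem theorem2 :
    (∀ (P : Polynomial ℕ) (a : ℕ),
      ∃ (K B : ℝ) (A : DistAlgorithm (Finset ℕ) ℕ),
        ∀ (V : Type*) [Fintype V] (G : SimpleGraph V) [DecidableRel G.Adj]
          (ident : V → ℕ) (L : V → Finset ℕ),
          ValidIdents a ident →
          (∀ v, ∀ x ∈ L v, x < P.eval G.maxDegree) →
          (∀ v, G.degree v + 1 ≤ (L v).card) →
          A.MessagesAtMost G ident L (B * Real.logb 2 (Fintype.card V)) ∧
          ∃ (t : ℕ) (C : G.Coloring ℕ),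
            (t : ℝ) ≤ roundBound K (Fintype.card V) G.maxDegree ∧
            A.OutputsAfter G ident L t C ∧ ∀ v, C v ∈ L v) ∧
    (∀ a : ℕ,
      ∃ (K B : ℝ) (A : DistAlgorithm Unit ℕ),
        ∀ (V : Type*) [Fintype V] (G : SimpleGraph V) [DecidableRel G.Adj]
          (ident : V → ℕ),
          ValidIdents a ident →
          A.MessagesAtMost G ident (fun _ => ()) (B * Real.logb 2 (Fintype.card V)) ∧
          ∃ (t : ℕ) (C : G.Coloring ℕ),
            (t : ℝ) ≤ roundBound K (Fintype.card V) G.maxDegree ∧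
            A.OutputsAfter G ident (fun _ => ()) t C ∧ ∀ v, C v < G.maxDegree + 1) := by
  refine ⟨fun P a => ⟨Prog.roundConstant P a, Prog.messageConstant P a,
    Prog.toAlgorithm (Prog.listColoring P a), ?_⟩,
    fun a => ⟨Prog.roundConstant (Polynomial.X + 1) a, Prog.messageConstant (Polynomial.X + 1) a,
      Prog.toAlgorithm fun x => Prog.listColoring (Polynomial.X + 1) a
      { x with input := Finset.range (x.maxDeg + 1) }, ?_⟩⟩
  · intro V _ G _ ident L hident hL hdeg
    obtain ⟨t, M, hruns, ht, hM⟩ := Prog.exists_runs_listColoring P a hident hL hdeg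
    obtain ⟨hmsg, y, ⟨hyL, hy⟩, hout⟩ :=
      Prog.messagesAtMost_and_outputsAfter hident.1 _ L hruns hM
    exact ⟨hmsg, t, SimpleGraph.Coloring.mk y fun {v u} h => hy v u h, ht, hout, hyL⟩
  · intro V _ G _ ident hident
    -- For `P = X + 1` every node can give itself the list of all `Δ + 1` colors, since it knows
    -- `Δ`.
    obtain ⟨t, M, hruns, ht, hM⟩ := Prog.exists_runs_listColoring (G := G)
      (L := fun _ => Finset.range (G.maxDegree + 1)) (Polynomial.X + 1) a hident
      (fun v x hx => by simpa using hx)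
      (fun v => by simpa using G.degree_le_maxDegree v)
    obtain ⟨hmsg, y, ⟨hyL, hy⟩, hout⟩ :=
      Prog.messagesAtMost_and_outputsAfter hident.1
        (fun x => Prog.listColoring (Polynomial.X + 1) a
          { x with input := Finset.range (x.maxDeg + 1) }) (fun _ => ()) hruns hM
    exact ⟨hmsg, t, SimpleGraph.Coloring.mk y fun {v u} h => hy v u h, ht, hout,
      fun v => Finset.mem_range.1 (hyL v)⟩
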